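/- Let $\Bbbk$ be $\mathbb R$ or $\mathbb C$, and fix a kind of geometry: differentiable ($C^\infty$), analytic or algebraic. A manifold $M$ (a non-singular variety in the algebraic case) is considered with its sheaf $\mathcal O_M$ of regular $\Bbbk$-valued functions. A supermanifold $S$ with reduced space $M$ is the manifold $M$ with a sheaf $\mathcal O_S$ of $\mathbb Z/2$-graded supercommutative $\Bbbk$-algebras and a homomorphism $\varepsilon:\mathcal O_S\to\mathcal O_M$ that is locally isomorphic, compatibly with gradings and with $\varepsilon$, to $\wedge^\bullet(\mathcal O_M^{\,n})\to\mathcal O_M$. Write $J$ for the kernel of $\varepsilon$ (the ideal generated by the odd functions), $T_+S=TM$ for the tangent bundle of $M$, and $T_-S=(J/J^2)^\vee$ for the odd tangent bundle, a vector bundle on $M$ (also denoted $T_\pm M$). $S$ is *projected* if $\varepsilon:\mathcal O_S\to\mathcal O_M$ has a section that is a homomorphism of sheaves of $\mathbb Z/2$-graded algebras. The *first obstruction class* $\omega_2(S)\in H^1\big(M,\mathrm{Hom}(\wedge^2T_-S,T_+S)\big)$ is defined as follows. Cover $M$ by open sets $U_i$ with isomorphisms of $\mathcal O_S|_{U_i}$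 with local models, which give even algebra sections $\sigma_i:\mathcal O_M|_{U_i}\to\mathcal O_S|_{U_i}$ of $\varepsilon$. On $U_i\cap U_j$ the difference $\sigma_j-\sigma_i$ modulo $J^3$ is a derivation of $\mathcal O_M$ with values in $J^2/J^3=\wedge^2T_-^\vee S$, that is, a section of $\mathrm{Hom}(\wedge^2T_-S,T_+S)$; these sections form a \v{C}ech cocycle, and $\omega_2(S)$ is its class. (It is the image, under passage to leading terms modulo $J^3$, of the non-abelian class of $S$ as a form of the split supermanifold $S(M,T_-S)$, and does not depend on the choices.) Let $f:S'\hookrightarrow S$ be a submanifold of a supermanifold $S$ of the same kind, with reduced spaces $M'\subset M$ (that is, $f$ is a morphism of supermanifolds that is a topological embedding $M'\to M$ and is surjective on the stalks $\mathcal O_{S,f(q)}\to\mathcal O_{S',q}$). The differential $T_+S'=TM'\to TM|_{M'}=T_+S|_{M'}$ induces $$j:H^1\big(M',\mathrm{Hom}(\wedge^2T_-S',T_+S')\big)\to H^1\big(M',\mathrm{Hom}(\wedge^2T_-S',T_+S|_{M'})\big),$$ and restriction to $M'$ followed by composition with $\wedge^2$ of the odd differential $T_-S'\to T_-S|_{M'}$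 induces $$\iota:H^1\big(M,\mathrm{Hom}(\wedge^2T_-S,T_+S)\big)\to H^1\big(M',\mathrm{Hom}(\wedge^2T_-S',T_+S|_{M'})\big).$$ Then: 1. $j(\omega_2(S'))=\iota(\omega_2(S))$. 2. If the even normal sequence $0\to TM'\to TM|_{M'}\to N\to0$ splits, that is, $TM'\to TM|_{M'}$ has a left inverse that is a morphism of vector bundles of the given kind, so that $TM|_{M'}\cong TM'\oplus N$, and if $\omega_2(S')\neq0$, then $\omega_2(S)\neq0$ and $S$ is not projected. -/

import Mathlib

open CategoryTheory TopologicalSpace Opposite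
open scoped ContDiff

universe u u' v w

noncomputable section

namespace SuperGeometry

/-! ### Spaces with functions and manifolds -/

/-- A topological space with a sheaf of `𝕜`-valued functions. -/
structure FunctionSpace (𝕜 : Type w) [Field 𝕜] where
  top : TopCat.{u}
  /-- The regular functions on an open set. -/
  fn : (U : Opens top) → Subalgebra 𝕜 (U → 𝕜)
  res_mem : ∀ {U V : Opens top} (h : U ≤ V) (f : V → 𝕜), f ∈ fn V →
    (fun x : U => f ⟨x, h x.2⟩) ∈ fn U
  local_mem : ∀ {U : Opens top} (f : U → 𝕜),
    (∀ x : U, ∃ (V : Opens top) (h : V ≤ U), (x : top) ∈ V ∧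
      (fun y : V => f ⟨y, h y.2⟩) ∈ fn V) → f ∈ fn U

namespace FunctionSpace

variable {𝕜 : Type w} [Field 𝕜]

/-- The algebra of regular functions on `U`. -/
def Fn (X : FunctionSpace.{u} 𝕜) (U : Opens X.top) : Type (max u w) := X.fn U

instance (X : FunctionSpace.{u} 𝕜) (U : Opens X.top) : CommRing (X.Fn U) :=
  inferInstanceAs (CommRing (X.fn U))

instance (X : FunctionSpace.{u} 𝕜) (U : Opens X.top) : Algebra 𝕜 (X.Fn U) :=
  inferInstanceAs (Algebra 𝕜 (X.fn U))

/-- The value at `p` of a regular function. -/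
def evalAt (X : FunctionSpace.{u} 𝕜) {W : Opens X.top} {p : X.top} (hp : p ∈ W) :
    X.Fn W →ₐ[𝕜] 𝕜 :=
  (Pi.evalAlgHom 𝕜 (fun _ : W => 𝕜) ⟨p, hp⟩).comp (X.fn W).val

/-- Restriction of regular functions. -/
def res (X : FunctionSpace.{u} 𝕜) {U V : Opens X.top} (h : U ≤ V) : X.Fn V →ₐ[𝕜] X.Fn U where
  toFun f := (⟨fun x => f.1 ⟨x, h x.2⟩, X.res_mem h f.1 f.2⟩ : X.fn U)
  map_one' := rfl
  map_mul' _ _ := rfl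
  map_zero' := rfl
  map_add' _ _ := rfl
  commutes' _ := rfl

/-- Near `p`, the space `X` is isomorphic to an open subspace of `Y`. -/
def IsModelledAt (X : FunctionSpace.{u} 𝕜) (Y : FunctionSpace.{u'} 𝕜) (p : X.top) : Prop :=
  ∃ e : OpenPartialHomeomorph X.top Y.top, p ∈ e.source ∧
    ∀ (W : Opens X.top) (V : Opens Y.top) (_ : (W : Set X.top) ⊆ e.source)
      (hV : e '' (W : Set X.top) = (V : Set Y.top)) (g : V → 𝕜),
      g ∈ Y.fn V ↔
        (fun x : W => g ⟨e x, by
          have h : e x ∈ e '' (W : Set X.top) := ⟨x, x.2, rfl⟩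
          rw [hV] at h
          exact h⟩) ∈ X.fn W

/-- A morphism of spaces with functions: a continuous map that pulls regular functions back to
regular functions. -/
structure Hom (X Y : FunctionSpace.{u} 𝕜) where
  toTop : X.top ⟶ Y.top
  comp_mem : ∀ (V : Opens Y.top) (g : V → 𝕜), g ∈ Y.fn V →
    (fun x : ((Opens.map toTop).obj V : Opens X.top) => g ⟨toTop x, x.2⟩) ∈
      X.fn ((Opens.map toTop).obj V)

/-- The identity morphism. -/
def Hom.id (X : FunctionSpace.{u} 𝕜) : Hom X X where
  toTop := 𝟙 _
  comp_mem _ _ h := h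

/-- The fibre at `p` of the tangent bundle: `𝕜`-linear derivations at `p` of germs of regular
functions, given as compatible families of derivations on the neighbourhoods of `p`. -/
def tangent (X : FunctionSpace.{u} 𝕜) (p : X.top) :
    Submodule 𝕜 ((U : OpenNhdsOf p) → X.Fn U.toOpens →ₗ[𝕜] 𝕜) where
  carrier := {v |
    (∀ (U V : OpenNhdsOf p) (h : U.toOpens ≤ V.toOpens) (f : X.Fn V.toOpens),
      v U (X.res h f) = v V f) ∧
    ∀ (U : OpenNhdsOf p) (f g : X.Fn U.toOpens),
      v U (f * g) = X.evalAt U.mem f * v U g + X.evalAt U.mem g * v U f}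
  zero_mem' := by simp
  add_mem' := by
    rintro v w ⟨h1, h2⟩ ⟨h3, h4⟩
    refine ⟨fun U V h f => ?_, fun U f g => ?_⟩
    · simp [h1 U V h f, h3 U V h f]
    · simp only [Pi.add_apply, LinearMap.add_apply, h2, h4]; ring
  smul_mem' := by
    rintro c v ⟨h1, h2⟩
    refine ⟨fun U V h f => ?_, fun U f g => ?_⟩
    · simp [h1 U V h f]
    · simp only [Pi.smul_apply, LinearMap.smul_apply, h2, smul_eq_mul]; ring

/-- The preimage of a neighbourhood. -/
def Hom.nhds {X Y : FunctionSpace.{u} 𝕜} (φ : Hom X Y) {p : X.top} (U : OpenNhdsOf (φ.toTop p)) :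
    OpenNhdsOf p :=
  ⟨(Opens.map φ.toTop).obj U.toOpens, U.2⟩

/-- Pull-back of regular functions. -/
def Hom.pull {X Y : FunctionSpace.{u} 𝕜} (φ : Hom X Y) (V : Opens Y.top) :
    Y.Fn V →ₐ[𝕜] X.Fn ((Opens.map φ.toTop).obj V) where
  toFun g := (⟨fun x => g.1 ⟨φ.toTop x, x.2⟩, φ.comp_mem V g.1 g.2⟩ :
    X.fn ((Opens.map φ.toTop).obj V))
  map_one' := rfl
  map_mul' _ _ := rfl
  map_zero' := rfl
  map_add' _ _ := rfl
  commutes' _ := rfl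

/-- The differential `T_p X → T_{φ(p)} Y`. -/
def Hom.diff {X Y : FunctionSpace.{u} 𝕜} (φ : Hom X Y) (p : X.top) :
    X.tangent p →ₗ[𝕜] Y.tangent (φ.toTop p) where
  toFun v := ⟨fun U => (v.1 (φ.nhds U)).comp (φ.pull U.toOpens).toLinearMap,
    fun U V h f => v.2.1 (φ.nhds U) (φ.nhds V) (fun _ hx => h hx) (φ.pull V.toOpens f),
    fun U f g => v.2.2 (φ.nhds U) (φ.pull U.toOpens f) (φ.pull U.toOpens g)⟩
  map_add' _ _ := rfl
  map_smul' _ _ := rfl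

end FunctionSpace

/-- The value at `x` of `f : U → 𝕜`, extended by zero. -/
def extendZero {X : Type*} {𝕜 : Type*} [Zero 𝕜] (U : Set X) (f : U → 𝕜) (x : X) : 𝕜 :=
  open Classical in if h : x ∈ U then f ⟨x, h⟩ else 0

/-- Affine space `𝕜ᵐ` with its sheaf of `Cⁿ` functions (`n = ∞` or `n = ω`). -/
def contDiffSpace (𝕜 : Type w) [RCLike 𝕜] (n : WithTop ℕ∞) (m : ℕ) : FunctionSpace.{w} 𝕜 where
  top := TopCat.of (EuclideanSpace 𝕜 (Fin m))
  fn U :=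
    { carrier := {f | ∀ x ∈ U, ContDiffAt 𝕜 n
        (extendZero (X := EuclideanSpace 𝕜 (Fin m)) (U : Set _) f) x}
      mul_mem' := by
        intro f g hf hg x hx
        refine ContDiffAt.congr_of_eventuallyEq ((hf x hx).mul (hg x hx))
          (Filter.Eventually.of_forall fun y => ?_)
        by_cases h : y ∈ (U : Set (EuclideanSpace 𝕜 (Fin m))) <;> simp [extendZero, h]
      add_mem' := by
        intro f g hf hg x hx
        refine ContDiffAt.congr_of_eventuallyEq ((hf x hx).add (hg x hx))
          (Filter.Eventually.of_forall fun y => ?_)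
        by_cases h : y ∈ (U : Set (EuclideanSpace 𝕜 (Fin m))) <;> simp [extendZero, h]
      algebraMap_mem' := by
        intro r x hx
        refine (contDiffAt_const (c := r)).congr_of_eventuallyEq ?_
        filter_upwards [U.isOpen.mem_nhds hx] with y hy
        have hy' : y ∈ (U : Set (EuclideanSpace 𝕜 (Fin m))) := hy
        simp only [extendZero, hy', dite_true]
        rfl }
  res_mem {U V} h f hf x hx := by
    refine (hf x (h hx)).congr_of_eventuallyEq ?_
    filter_upwards [U.isOpen.mem_nhds hx] with y hy
    have hy' : y ∈ (U : Set (EuclideanSpace 𝕜 (Fin m))) := hy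
    have hy'' : y ∈ (V : Set (EuclideanSpace 𝕜 (Fin m))) := h hy
    simp only [extendZero, hy', hy'', dite_true]
  local_mem {U} f hf x hx := by
    obtain ⟨V, h, hxV, hV⟩ := hf ⟨x, hx⟩
    refine (hV x hxV).congr_of_eventuallyEq ?_
    filter_upwards [V.isOpen.mem_nhds hxV] with y hy
    have hy' : y ∈ (V : Set (EuclideanSpace 𝕜 (Fin m))) := hy
    have hy'' : y ∈ (U : Set (EuclideanSpace 𝕜 (Fin m))) := h hy
    simp only [extendZero, hy', hy'', dite_true]

/-- A `𝕜`-point of the affine variety with coordinate algebra `A`. -/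
structure Points (𝕜 A : Type w) [Field 𝕜] [CommRing A] [Algebra 𝕜 A] where
  eval : A →ₐ[𝕜] 𝕜

/-- The Zariski topology. -/
instance (𝕜 A : Type w) [Field 𝕜] [CommRing A] [Algebra 𝕜 A] : TopologicalSpace (Points 𝕜 A) :=
  TopologicalSpace.generateFrom (Set.range fun a : A => {x : Points 𝕜 A | x.eval a ≠ 0})

/-- The affine variety with coordinate algebra `A`: its points, with the Zariski topology and the
functions that are locally quotients of elements of `A`. -/
def affineVariety (𝕜 A : Type w) [Field 𝕜] [CommRing A] [Algebra 𝕜 A] : FunctionSpace.{w} 𝕜 where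
  top := TopCat.of (Points 𝕜 A)
  fn U :=
    { carrier := {f | ∀ x : U, ∃ (a b : A) (V : Opens (Points 𝕜 A)), x.1 ∈ V ∧
        ∀ y : U, y.1 ∈ V → y.1.eval b ≠ 0 ∧ f y = y.1.eval a / y.1.eval b}
      mul_mem' := by
        intro f g hf hg x
        obtain ⟨a, b, V, hV, h⟩ := hf x
        obtain ⟨a', b', V', hV', h'⟩ := hg x
        refine ⟨a * a', b * b', V ⊓ V', ⟨hV, hV'⟩, fun y hy => ?_⟩
        obtain ⟨h1, h2⟩ := h y hy.1
        obtain ⟨h3, h4⟩ := h' y hy.2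
        simp only [map_mul]
        exact ⟨mul_ne_zero h1 h3, by rw [Pi.mul_apply, h2, h4]; field_simp⟩
      add_mem' := by
        intro f g hf hg x
        obtain ⟨a, b, V, hV, h⟩ := hf x
        obtain ⟨a', b', V', hV', h'⟩ := hg x
        refine ⟨a * b' + a' * b, b * b', V ⊓ V', ⟨hV, hV'⟩, fun y hy => ?_⟩
        obtain ⟨h1, h2⟩ := h y hy.1
        obtain ⟨h3, h4⟩ := h' y hy.2
        simp only [map_mul, map_add]
        exact ⟨mul_ne_zero h1 h3, by rw [Pi.add_apply, h2, h4]; field_simp⟩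
      algebraMap_mem' := by
        intro r x
        refine ⟨algebraMap 𝕜 A r, 1, ⊤, trivial, fun y _ => ?_⟩
        simp }
  res_mem {U V} h f hf x := by
    obtain ⟨a, b, W, hW, H⟩ := hf ⟨x, h x.2⟩
    exact ⟨a, b, W, hW, fun y hy => H ⟨y, h y.2⟩ hy⟩
  local_mem {U} f hf x := by
    obtain ⟨V, h, hxV, hV⟩ := hf x
    obtain ⟨a, b, W, hW, H⟩ := hV ⟨x, hxV⟩
    exact ⟨a, b, V ⊓ W, ⟨hxV, hW⟩, fun y hy => H ⟨y, hy.1⟩ hy.2⟩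

/-- The kinds of geometry: differentiable (`C^∞`), analytic, algebraic. -/
inductive Geometry
  | differentiable
  | analytic
  | algebraic

/-- Manifolds: spaces with functions that are locally isomorphic to open subspaces of affine space
with its `C^∞` or analytic functions or, in the algebraic case, of a non-singular affine
variety. -/
def FunctionSpace.IsManifold {𝕜 : Type w} [RCLike 𝕜] (X : FunctionSpace.{u} 𝕜) :
    Geometry → Prop
  | .differentiable => ∀ p, ∃ m : ℕ, X.IsModelledAt (contDiffSpace 𝕜 ∞ m) p
  | .analytic => ∀ p, ∃ m : ℕ, X.IsModelledAt (contDiffSpace 𝕜 ω m) p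
  | .algebraic => ∀ p, ∃ (A : Type w) (_ : CommRing A) (_ : Algebra 𝕜 A),
      Algebra.Smooth 𝕜 A ∧ X.IsModelledAt (affineVariety 𝕜 A) p

/-! ### Supermanifolds -/

/-- Sections over `U` of a sheaf of algebras. -/
abbrev sec {𝕜 : Type w} [Field 𝕜] {X : TopCat.{u}} (F : TopCat.Sheaf (AlgCat.{v} 𝕜) X)
    (U : Opens X) : Type v :=
  F.presheaf.obj (op U)

/-- Restriction of sections of a sheaf of algebras. -/
abbrev secRes {𝕜 : Type w} [Field 𝕜] {X : TopCat.{u}} (F : TopCat.Sheaf (AlgCat.{v} 𝕜) X)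
    {U V : Opens X} (h : U ≤ V) : sec F V →ₐ[𝕜] sec F U :=
  (F.presheaf.map (homOfLE h).op).hom

/-- A space with functions `red`, a sheaf `O` of `ℤ/2`-graded supercommutative algebras on it and
a homomorphism `ε` from `O` to the sheaf of regular functions. -/
structure SuperSpace (𝕜 : Type w) [Field 𝕜] where
  red : FunctionSpace.{u} 𝕜
  O : TopCat.Sheaf (AlgCat.{v} 𝕜) red.top
  even : ∀ U, Submodule 𝕜 (sec O U)
  odd : ∀ U, Submodule 𝕜 (sec O U)
  isCompl : ∀ U, IsCompl (even U) (odd U)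
  one_even : ∀ U, 1 ∈ even U
  even_mul_even : ∀ {U} {x y : sec O U}, x ∈ even U → y ∈ even U → x * y ∈ even U
  even_mul_odd : ∀ {U} {x y : sec O U}, x ∈ even U → y ∈ odd U → x * y ∈ odd U
  odd_mul_odd : ∀ {U} {x y : sec O U}, x ∈ odd U → y ∈ odd U → x * y ∈ even U
  even_comm : ∀ {U} {x : sec O U}, x ∈ even U → ∀ y, x * y = y * x
  odd_anticomm : ∀ {U} {x y : sec O U}, x ∈ odd U → y ∈ odd U → x * y = -(y * x)
  res_even : ∀ {U V} (h : U ≤ V) {x : sec O V}, x ∈ even V → secRes O h x ∈ even U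
  res_odd : ∀ {U V} (h : U ≤ V) {x : sec O V}, x ∈ odd V → secRes O h x ∈ odd U
  ε : ∀ U, sec O U →ₐ[𝕜] red.Fn U
  ε_res : ∀ {U V} (h : U ≤ V) (x : sec O V), ε U (secRes O h x) = red.res h (ε V x)

/-- The algebra of functions on the standard local model of odd dimension `n`: the exterior
algebra over the regular functions on `W` on `n` odd generators. -/
abbrev Grassmann {𝕜 : Type w} [Field 𝕜] (X : FunctionSpace.{u} 𝕜) (n : ℕ) (W : Opens X.top) :=
  ExteriorAlgebra (X.Fn W) (Fin n → X.Fn W)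

/-- Change of scalars `⋀ Rⁿ → ⋀ R'ⁿ` along a ring homomorphism `R → R'`. -/
def grassmannMap {R R' : Type*} [CommRing R] [CommRing R'] (ρ : R →+* R') (n : ℕ) :
    ExteriorAlgebra R (Fin n → R) →+* ExteriorAlgebra R' (Fin n → R') :=
  letI := ρ.toAlgebra
  (ExteriorAlgebra.lift R
    ⟨{ toFun := fun m => ExteriorAlgebra.ι R' (fun a => ρ (m a))
       map_add' := fun m m' => by
        rw [← map_add]; congr 1; funext a; simp
       map_smul' := fun r m => by
        have h : (fun a => ρ ((r • m) a)) = ρ r • fun a => ρ (m a) := by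
          funext a; simp
        rw [h, map_smul]
        exact algebraMap_smul R' r (ExteriorAlgebra.ι R' fun a => ρ (m a)) },
      fun m => ExteriorAlgebra.ι_sq_zero _⟩).toRingHom

theorem grassmannMap_algebraMap {R R' : Type*} [CommRing R] [CommRing R'] (ρ : R →+* R') (n : ℕ)
    (r : R) : grassmannMap ρ n (algebraMap R _ r) = algebraMap R' _ (ρ r) := by
  let _ := ρ.toAlgebra
  refine (AlgHom.commutes _ r).trans ?_
  rfl

theorem grassmannMap_ι {R R' : Type*} [CommRing R] [CommRing R'] (ρ : R →+* R') (n : ℕ)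
    (m : Fin n → R) :
    grassmannMap ρ n (ExteriorAlgebra.ι R m) = ExteriorAlgebra.ι R' (fun a => ρ (m a)) := by
  let _ := ρ.toAlgebra
  exact ExteriorAlgebra.lift_ι_apply R _ _ m

/-- An isomorphism of `ℤ/2`-graded algebras, over the reduced space, of the restriction of `S`
to `U` with the local model `S(U, 𝒪ⁿ)`. -/
structure SuperSpace.Chart {𝕜 : Type w} [Field 𝕜] (S : SuperSpace.{u, v} 𝕜) (U : Opens S.red.top)
    (n : ℕ) where
  iso : ∀ W, W ≤ U → sec S.O W ≃ₐ[𝕜] Grassmann S.red n W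
  iso_res : ∀ {W W'} (h : W' ≤ W) (hW : W ≤ U) (x : sec S.O W),
    iso W' (h.trans hW) (secRes S.O h x) =
      grassmannMap (S.red.res h).toRingHom n (iso W hW x)
  even_iff : ∀ {W} (hW : W ≤ U) (x : sec S.O W),
    x ∈ S.even W ↔ iso W hW x ∈ CliffordAlgebra.evenOdd (0 : QuadraticForm (S.red.Fn W) _) 0
  odd_iff : ∀ {W} (hW : W ≤ U) (x : sec S.O W),
    x ∈ S.odd W ↔ iso W hW x ∈ CliffordAlgebra.evenOdd (0 : QuadraticForm (S.red.Fn W) _) 1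
  ε_eq : ∀ {W} (hW : W ≤ U) (x : sec S.O W),
    S.ε W x = ExteriorAlgebra.algebraMapInv (iso W hW x)

/-- A supermanifold: a superspace over a manifold that is locally isomorphic to local models. -/
structure Supermanifold (𝕜 : Type w) [RCLike 𝕜] (g : Geometry) extends SuperSpace.{u, v} 𝕜 where
  isManifold : red.IsManifold g
  exists_chart : ∀ p : red.top, ∃ (U : Opens red.top) (n : ℕ), p ∈ U ∧
    Nonempty (toSuperSpace.Chart U n)

/-- A morphism of supermanifolds: a morphism of the reduced spaces and a compatible homomorphism
of sheaves of `ℤ/2`-graded algebras. -/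
structure SuperSpace.Hom {𝕜 : Type w} [Field 𝕜] (S' S : SuperSpace.{u, v} 𝕜) where
  red : FunctionSpace.Hom S'.red S.red
  sharp : S.O.presheaf ⟶ (TopCat.Presheaf.pushforward (AlgCat.{v} 𝕜) red.toTop).obj S'.O.presheaf
  map_even : ∀ {U} {x : sec S.O U}, x ∈ S.even U →
    (sharp.app (op U)).hom x ∈ S'.even ((Opens.map red.toTop).obj U)
  map_odd : ∀ {U} {x : sec S.O U}, x ∈ S.odd U →
    (sharp.app (op U)).hom x ∈ S'.odd ((Opens.map red.toTop).obj U)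
  ε_sharp : ∀ {U} (x : sec S.O U),
    S'.ε ((Opens.map red.toTop).obj U) ((sharp.app (op U)).hom x) = red.pull U (S.ε U x)

namespace SuperSpace

variable {𝕜 : Type w} [Field 𝕜]

/-- The algebra homomorphism `𝒪_S(U) → 𝒪_S'(f⁻¹ U)`. -/
def Hom.pull {S' S : SuperSpace.{u, v} 𝕜} (f : Hom S' S) (U : Opens S.red.top) :
    sec S.O U →ₐ[𝕜] sec S'.O ((Opens.map f.red.toTop).obj U) :=
  (f.sharp.app (op U)).hom

theorem Hom.pull_res {S' S : SuperSpace.{u, v} 𝕜} (f : Hom S' S) {U V : Opens S.red.top}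
    (h : U ≤ V) (x : sec S.O V) :
    f.pull U (secRes S.O h x) =
      secRes S'.O (show (Opens.map f.red.toTop).obj U ≤ (Opens.map f.red.toTop).obj V from
        fun _ hx => h hx) (f.pull V x) := by
  have := f.sharp.naturality (homOfLE h).op
  have := congrArg (fun k => k.hom x) this
  exact this

/-- `f` exhibits `S'` as a submanifold of `S`: it is a topological embedding and the homomorphisms
of stalks `𝒪_{S, f(q)} → 𝒪_{S', q}` are surjective. -/
def Hom.IsSubmanifold {S' S : SuperSpace.{u, v} 𝕜} (f : Hom S' S) : Prop :=
  Topology.IsEmbedding f.red.toTop ∧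
    ∀ (q : S'.red.top) (W : OpenNhdsOf q) (y : sec S'.O W.toOpens),
      ∃ (V : OpenNhdsOf (f.red.toTop q)) (x : sec S.O V.toOpens) (W' : OpenNhdsOf q)
        (h : W'.toOpens ≤ W.toOpens) (h' : W'.toOpens ≤ (Opens.map f.red.toTop).obj V.toOpens),
        secRes S'.O h y = secRes S'.O h' (f.pull V.toOpens x)

/-- `S` is projected: the projection of `𝒪_S` to the sheaf of regular functions on the reduced
space has a section that is a homomorphism of sheaves of (`ℤ/2`-graded) algebras, in other words
there is a projection of `S` to its reduced space. -/
def IsProjected (S : SuperSpace.{u, v} 𝕜) : Prop :=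
  ∃ σ : ∀ U, S.red.Fn U →ₐ[𝕜] sec S.O U,
    (∀ U f, σ U f ∈ S.even U) ∧
    (∀ {U V} (h : U ≤ V) (f : S.red.Fn V), σ U (S.red.res h f) = secRes S.O h (σ V f)) ∧
    ∀ U f, S.ε U (σ U f) = f

/-- The fibre at `p` of the odd tangent bundle `T₋S`: the `𝕜`-linear derivations at `p` of germs of
sections of `𝒪_S` that vanish on even germs. (As `ε` kills the odd sections, the Leibniz rule needs
no sign.) -/
def oddTangent (S : SuperSpace.{u, v} 𝕜) (p : S.red.top) :
    Submodule 𝕜 ((U : OpenNhdsOf p) → sec S.O U.toOpens →ₗ[𝕜] 𝕜) where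
  carrier := {v |
    (∀ (U V : OpenNhdsOf p) (h : U.toOpens ≤ V.toOpens) (x : sec S.O V.toOpens),
      v U (secRes S.O h x) = v V x) ∧
    (∀ (U : OpenNhdsOf p) (x y : sec S.O U.toOpens),
      v U (x * y) = v U x * S.red.evalAt U.mem (S.ε _ y) + S.red.evalAt U.mem (S.ε _ x) * v U y) ∧
    ∀ (U : OpenNhdsOf p) (x : sec S.O U.toOpens), x ∈ S.even _ → v U x = 0}
  zero_mem' := by simp
  add_mem' := by
    rintro v w ⟨h1, h2, h3⟩ ⟨h4, h5, h6⟩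
    refine ⟨fun U V h f => ?_, fun U f g => ?_, fun U x hx => ?_⟩
    · simp [h1 U V h f, h4 U V h f]
    · simp only [Pi.add_apply, LinearMap.add_apply, h2, h5]; ring
    · simp [h3 U x hx, h6 U x hx]
  smul_mem' := by
    rintro c v ⟨h1, h2, h3⟩
    refine ⟨fun U V h f => ?_, fun U f g => ?_, fun U x hx => ?_⟩
    · simp [h1 U V h f]
    · simp only [Pi.smul_apply, LinearMap.smul_apply, h2, smul_eq_mul]; ring
    · simp [h3 U x hx]

/-- The odd differential `T₋,q S' → T₋,f(q) S`. -/
def Hom.oddDiff {S' S : SuperSpace.{u, v} 𝕜} (f : Hom S' S) (q : S'.red.top) :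
    S'.oddTangent q →ₗ[𝕜] S.oddTangent (f.red.toTop q) where
  toFun v := ⟨fun U => (v.1 (f.red.nhds U)).comp (f.pull U.toOpens).toLinearMap,
    fun U V h x => by
      refine Eq.trans ?_ (v.2.1 (f.red.nhds U) (f.red.nhds V) (fun _ hx => h hx)
        (f.pull V.toOpens x))
      exact congrArg (v.1 (f.red.nhds U)) (f.pull_res h x),
    fun U x y => by
      have h := v.2.2.1 (f.red.nhds U) (f.pull U.toOpens x) (f.pull U.toOpens y)
      have hx : S'.ε _ (f.pull U.toOpens x) = _ := f.ε_sharp x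
      have hy : S'.ε _ (f.pull U.toOpens y) = _ := f.ε_sharp y
      refine Eq.trans (congrArg (v.1 (f.red.nhds U)) (map_mul (f.pull U.toOpens) x y)) ?_
      refine h.trans ?_
      erw [hx, hy]
      rfl,
    fun U x hx => v.2.2.2 (f.red.nhds U) _ (f.map_even hx)⟩
  map_add' _ _ := rfl
  map_smul' _ _ := rfl

/-- A family of odd tangent vectors over `W` is a section of `T₋S` if it takes sections of `𝒪_S`
to regular functions. -/
def IsOddField (S : SuperSpace.{u, v} 𝕜) {W : Opens S.red.top} (v : ∀ q : W, S.oddTangent q.1) :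
    Prop :=
  ∀ (V : Opens S.red.top) (h : V ≤ W) (x : sec S.O V),
    (fun q : V => (v ⟨q.1, h q.2⟩).1 ⟨V, q.2⟩ x) ∈ S.red.fn V

end SuperSpace

/-! ### First Čech cohomology -/

section Cech

variable {X Y : TopCat.{u}}

/-- Restriction of sections of a presheaf of abelian groups. -/
abbrev abRes (A : X.Presheaf AddCommGrpCat.{w}) {U V : Opens X} (h : U ≤ V) :
    A.obj (op V) →+ A.obj (op U) :=
  (A.map (homOfLE h).op).hom

theorem abRes_abRes (A : X.Presheaf AddCommGrpCat.{w}) {U V W : Opens X} (h : U ≤ V) (h' : V ≤ W)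
    (x : A.obj (op W)) : abRes A h (abRes A h' x) = abRes A (h.trans h') x := by
  have := congrArg (fun k => k.hom x) (A.map_comp (homOfLE h').op (homOfLE h).op)
  exact this.symm

/-- Open covers of `X` indexed by the points of `X`, ordered by refinement (finer covers are
larger). Every open cover is refined by a cover of this form. -/
abbrev PointCover (X : TopCat.{u}) := ∀ x : X, (OpenNhdsOf x)ᵒᵈ

/-- The open set with index `x`. -/
def PointCover.at (𝒰 : PointCover X) (x : X) : Opens X := (OrderDual.ofDual (𝒰 x)).toOpens

theorem PointCover.le_at {𝒰 𝒱 : PointCover X} (h : 𝒰 ≤ 𝒱) (x : X) : 𝒱.at x ≤ 𝒰.at x := h x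

theorem PointCover.mem_at (𝒰 : PointCover X) (x : X) : x ∈ 𝒰.at x := (OrderDual.ofDual (𝒰 x)).mem

/-- Čech 1-cochains. -/
abbrev Cochain (A : X.Presheaf AddCommGrpCat.{w}) (𝒰 : PointCover X) : Type (max u w) :=
  ∀ x y : X, A.obj (op (𝒰.at x ⊓ 𝒰.at y))

/-- Čech 1-cocycles. -/
def cocycles (A : X.Presheaf AddCommGrpCat.{w}) (𝒰 : PointCover X) : AddSubgroup (Cochain A 𝒰) where
  carrier := {c | ∀ x y z : X,
    abRes A (show 𝒰.at x ⊓ 𝒰.at y ⊓ 𝒰.at z ≤ 𝒰.at x ⊓ 𝒰.at y from inf_le_left) (c x y) +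
      abRes A (show 𝒰.at x ⊓ 𝒰.at y ⊓ 𝒰.at z ≤ 𝒰.at y ⊓ 𝒰.at z from
        inf_le_inf_right _ inf_le_right) (c y z) =
      abRes A (show 𝒰.at x ⊓ 𝒰.at y ⊓ 𝒰.at z ≤ 𝒰.at x ⊓ 𝒰.at z from
        inf_le_inf_right _ inf_le_left) (c x z)}
  zero_mem' := fun x y z => by simp
  add_mem' := fun {c d} hc hd x y z => by
    simp only [Pi.add_apply, map_add]
    rw [← hc x y z, ← hd x y z]; abel
  neg_mem' := fun {c} hc x y z => by
    simp only [Pi.neg_apply, map_neg]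
    rw [← hc x y z]; abel

/-- The Čech differential from 0-cochains to 1-cocycles. -/
def coboundary (A : X.Presheaf AddCommGrpCat.{w}) (𝒰 : PointCover X) :
    (∀ x : X, A.obj (op (𝒰.at x))) →+ cocycles A 𝒰 where
  toFun b := ⟨fun x y => abRes A inf_le_right (b y) - abRes A inf_le_left (b x), fun x y z => by
    simp only [map_sub, abRes_abRes]; abel⟩
  map_zero' := by ext x y; simp
  map_add' b b' := by
    apply Subtype.ext; funext x y
    simp only [Pi.add_apply, map_add, AddSubgroup.coe_add]; abel

/-- First Čech cohomology of a cover. -/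
abbrev CechH1 (A : X.Presheaf AddCommGrpCat.{w}) (𝒰 : PointCover X) : Type (max u w) :=
  cocycles A 𝒰 ⧸ (coboundary A 𝒰).range

/-- Pull-back of cocycles along a continuous map `f : Y → X`, a cover of `Y` that is finer than the
preimage of the cover of `X`, and a morphism `A → f_* B`. -/
def pullCocycle (f : Y ⟶ X) (A : X.Presheaf AddCommGrpCat.{w}) (B : Y.Presheaf AddCommGrpCat.{w})
    (φ : A ⟶ (TopCat.Presheaf.pushforward AddCommGrpCat.{w} f).obj B) (𝒰 : PointCover X)
    (𝒱 : PointCover Y) (h : ∀ y, 𝒱.at y ≤ (Opens.map f).obj (𝒰.at (f y))) :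
    cocycles A 𝒰 →+ cocycles B 𝒱 where
  toFun c := ⟨fun y y' =>
    abRes B (show 𝒱.at y ⊓ 𝒱.at y' ≤ (Opens.map f).obj (𝒰.at (f y) ⊓ 𝒰.at (f y')) from
      inf_le_inf (h y) (h y')) ((φ.app (op _)).hom (c.1 (f y) (f y'))), fun x y z => by
    have key : ∀ {U V : Opens X} (hUV : U ≤ V) (W : Opens Y) (hW : W ≤ (Opens.map f).obj U)
        (hW' : W ≤ (Opens.map f).obj V) (a : A.obj (op V)),
        abRes B hW' ((φ.app (op V)).hom a) = abRes B hW ((φ.app (op U)).hom (abRes A hUV a)) := by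
      intro U V hUV W hW hW' a
      have := congrArg (fun k => k.hom a) (φ.naturality (homOfLE hUV).op)
      refine Eq.trans ?_ (congrArg (abRes B hW) this.symm)
      exact (abRes_abRes B hW (show (Opens.map f).obj U ≤ (Opens.map f).obj V from
        fun _ hx => hUV hx) ((φ.app (op V)).hom a)).symm
    have hW : 𝒱.at x ⊓ 𝒱.at y ⊓ 𝒱.at z ≤
        (Opens.map f).obj (𝒰.at (f x) ⊓ 𝒰.at (f y) ⊓ 𝒰.at (f z)) :=
      inf_le_inf (inf_le_inf (h x) (h y)) (h z)
    simp only [abRes_abRes]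
    rw [key (U := 𝒰.at (f x) ⊓ 𝒰.at (f y) ⊓ 𝒰.at (f z)) inf_le_left _ hW,
      key (U := 𝒰.at (f x) ⊓ 𝒰.at (f y) ⊓ 𝒰.at (f z)) (inf_le_inf_right _ inf_le_right) _ hW,
      key (U := 𝒰.at (f x) ⊓ 𝒰.at (f y) ⊓ 𝒰.at (f z)) (inf_le_inf_right _ inf_le_left) _ hW,
      ← c.2 (f x) (f y) (f z), map_add, map_add]⟩
  map_zero' := by ext x y; simp
  map_add' b b' := by
    apply Subtype.ext; funext x y
    simp only [Pi.add_apply, map_add, AddSubgroup.coe_add]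

/-- Pull-back on the first Čech cohomology of covers. -/
def pullCechH1 (f : Y ⟶ X) (A : X.Presheaf AddCommGrpCat.{w}) (B : Y.Presheaf AddCommGrpCat.{w})
    (φ : A ⟶ (TopCat.Presheaf.pushforward AddCommGrpCat.{w} f).obj B) (𝒰 : PointCover X)
    (𝒱 : PointCover Y) (h : ∀ y, 𝒱.at y ≤ (Opens.map f).obj (𝒰.at (f y))) :
    CechH1 A 𝒰 →+ CechH1 B 𝒱 :=
  QuotientAddGroup.map _ _ (pullCocycle f A B φ 𝒰 𝒱 h) <| by
    rintro _ ⟨b, rfl⟩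
    refine ⟨fun y => abRes B (h y) ((φ.app (op (𝒰.at (f y)))).hom (b (f y))), ?_⟩
    apply Subtype.ext; funext y y'
    have key : ∀ {U V : Opens X} (hUV : U ≤ V) (W : Opens Y) (hW : W ≤ (Opens.map f).obj U)
        (hW' : W ≤ (Opens.map f).obj V) (a : A.obj (op V)),
        abRes B hW' ((φ.app (op V)).hom a) = abRes B hW ((φ.app (op U)).hom (abRes A hUV a)) := by
      intro U V hUV W hW hW' a
      have := congrArg (fun k => k.hom a) (φ.naturality (homOfLE hUV).op)
      refine Eq.trans ?_ (congrArg (abRes B hW) this.symm)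
      exact (abRes_abRes B hW (show (Opens.map f).obj U ≤ (Opens.map f).obj V from
        fun _ hx => hUV hx) ((φ.app (op V)).hom a)).symm
    have hW : 𝒱.at y ⊓ 𝒱.at y' ≤ (Opens.map f).obj (𝒰.at (f y) ⊓ 𝒰.at (f y')) :=
      inf_le_inf (h y) (h y')
    simp only [coboundary, pullCocycle, AddMonoidHom.coe_mk, ZeroHom.coe_mk, abRes_abRes, map_sub]
    rw [key (U := 𝒰.at (f y) ⊓ 𝒰.at (f y')) inf_le_left _ hW,
      key (U := 𝒰.at (f y) ⊓ 𝒰.at (f y')) inf_le_right _ hW]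

/-- A morphism `A → B` as a morphism from `A` to the direct image of `B` under the identity. -/
def toPushforwardId {A B : X.Presheaf AddCommGrpCat.{w}} (α : A ⟶ B) :
    A ⟶ (TopCat.Presheaf.pushforward AddCommGrpCat.{w} (𝟙 X)).obj B where
  app U := α.app U
  naturality _ _ i := α.naturality i

/-- The refinement maps. -/
def refineH1 (A : X.Presheaf AddCommGrpCat.{w}) (𝒰 𝒱 : PointCover X) (h : 𝒰 ≤ 𝒱) :
    CechH1 A 𝒰 →+ CechH1 A 𝒱 :=
  pullCechH1 (𝟙 X) A A (toPushforwardId (𝟙 A)) 𝒰 𝒱 fun x => PointCover.le_at h x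

open Classical in
/-- The first cohomology `H¹(X, A)`: the direct limit of the first Čech cohomology of the open
covers of `X` under refinement. (For a sheaf on any space this is sheaf cohomology in degree 1.) -/
def H1 (A : X.Presheaf AddCommGrpCat.{w}) : Type (max u w) :=
  AddCommGroup.DirectLimit (CechH1 A) (refineH1 A)

open Classical in
instance (A : X.Presheaf AddCommGrpCat.{w}) : AddCommGroup (H1 A) :=
  inferInstanceAs (AddCommGroup (AddCommGroup.DirectLimit (CechH1 A) (refineH1 A)))

open Classical in
/-- The class of a cocycle. -/
def H1.mk (A : X.Presheaf AddCommGrpCat.{w}) (𝒰 : PointCover X) : cocycles A 𝒰 →+ H1 A :=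
  (AddCommGroup.DirectLimit.of (CechH1 A) (refineH1 A) 𝒰).comp (QuotientAddGroup.mk' _)

/-- The preimage of a cover. -/
def PointCover.comap (f : Y ⟶ X) (𝒰 : PointCover X) : PointCover Y :=
  fun y => OrderDual.toDual ⟨(Opens.map f).obj (𝒰.at (f y)), 𝒰.mem_at (f y)⟩

open Classical in
/-- The map `H¹(X, A) → H¹(Y, B)` induced by a continuous map `f : Y → X` and a morphism
`A → f_* B`. -/
def H1.pull (f : Y ⟶ X) {A : X.Presheaf AddCommGrpCat.{w}} {B : Y.Presheaf AddCommGrpCat.{w}}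
    (φ : A ⟶ (TopCat.Presheaf.pushforward AddCommGrpCat.{w} f).obj B) : H1 A →+ H1 B :=
  AddCommGroup.DirectLimit.lift (CechH1 A) (refineH1 A) (H1 B)
    (fun 𝒰 => (AddCommGroup.DirectLimit.of (CechH1 B) (refineH1 B) (𝒰.comap f)).comp
      (pullCechH1 f A B φ 𝒰 (𝒰.comap f) fun _ => le_rfl))
    (by
      intro 𝒰 𝒱 h c
      have hle : 𝒰.comap f ≤ 𝒱.comap f := fun y _ hz => PointCover.le_at h (f y) hz
      induction c using QuotientAddGroup.induction_on with | _ c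
      refine Eq.trans ?_ (AddCommGroup.DirectLimit.of_f (G := CechH1 B) (f := refineH1 B) hle _)
      refine congrArg (AddCommGroup.DirectLimit.of (CechH1 B) (refineH1 B) (𝒱.comap f)) ?_
      refine congrArg (QuotientAddGroup.mk' (coboundary B (𝒱.comap f)).range) ?_
      apply Subtype.ext; funext y y'
      have := congrArg (fun k => k.hom (c.1 (f y) (f y'))) (φ.naturality
        (homOfLE (show 𝒱.at (f y) ⊓ 𝒱.at (f y') ≤ 𝒰.at (f y) ⊓ 𝒰.at (f y') from
          inf_le_inf (PointCover.le_at h _) (PointCover.le_at h _))).op)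
      refine (congrArg (abRes B _) this).trans ?_
      refine (abRes_abRes B _ _ _).trans ?_
      exact (abRes_abRes B _ _ _).symm)

/-- The map `H¹(X, A) → H¹(X, B)` induced by a morphism `A → B`. -/
def H1.map {A B : X.Presheaf AddCommGrpCat.{w}} (α : A ⟶ B) : H1 A →+ H1 B :=
  H1.pull (𝟙 X) (toPushforwardId α)

end Cech

/-! ### Contractions in exterior algebras -/

section Contraction

open CliffordAlgebra

variable {R M : Type*} [CommRing R] [AddCommGroup M] [Module R M]

/-- The augmentation `⋀ M → R`. -/
local notation "aug" => (ExteriorAlgebra.algebraMapInv : ExteriorAlgebra R M →ₐ[R] R)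

theorem aug_ι_mul (m : M) (X : ExteriorAlgebra R M) : aug (ExteriorAlgebra.ι R m * X) = 0 := by
  simp [ExteriorAlgebra.algebraMapInv]

theorem aug_odd {X : ExteriorAlgebra R M} (hX : X ∈ evenOdd (0 : QuadraticForm R M) 1) :
    aug X = 0 := by
  induction X, hX using CliffordAlgebra.odd_induction with
  | ι v => simpa using aug_ι_mul v (1 : ExteriorAlgebra R M)
  | add x y hx hy h1 h2 => rw [map_add, h1, h2, add_zero]
  | ι_mul_ι_mul m₁ m₂ x hx h => rw [map_mul, h, mul_zero]

theorem contract_even_mul (d : Module.Dual R M) {X : ExteriorAlgebra R M}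
    (hX : X ∈ evenOdd (0 : QuadraticForm R M) 0) (Y : ExteriorAlgebra R M) :
    contractLeft d (X * Y) = contractLeft d X * Y + X * contractLeft d Y := by
  induction X, hX using CliffordAlgebra.even_induction with
  | algebraMap r => simp [contractLeft_algebraMap_mul]
  | add x y hx hy h1 h2 => rw [add_mul, map_add, h1, h2, map_add]; noncomm_ring
  | ι_mul_ι_mul m₁ m₂ x hx h =>
    simp only [mul_assoc, contractLeft_ι_mul, h]
    simp only [mul_add, mul_sub, smul_mul_assoc, mul_smul_comm, sub_mul, mul_assoc]
    abel

theorem contract_odd_mul (d : Module.Dual R M) {X : ExteriorAlgebra R M}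
    (hX : X ∈ evenOdd (0 : QuadraticForm R M) 1) (Y : ExteriorAlgebra R M) :
    contractLeft d (X * Y) = contractLeft d X * Y - X * contractLeft d Y := by
  induction X, hX using CliffordAlgebra.odd_induction with
  | ι v => rw [contractLeft_ι_mul, contractLeft_ι, Algebra.smul_def]
  | add x y hx hy h1 h2 => rw [add_mul, map_add, h1, h2, map_add]; noncomm_ring
  | ι_mul_ι_mul m₁ m₂ x hx h =>
    simp only [mul_assoc, contractLeft_ι_mul, h]
    simp only [mul_sub, smul_mul_assoc, mul_smul_comm, sub_mul, mul_assoc]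
    abel

theorem aug_contract_mul (d : Module.Dual R M) (X Y : ExteriorAlgebra R M) :
    aug (contractLeft d (X * Y)) =
      aug (contractLeft d X) * aug Y + aug X * aug (contractLeft d Y) := by
  induction X using CliffordAlgebra.left_induction with
  | algebraMap r => simp [contractLeft_algebraMap_mul]
  | add x y h1 h2 => rw [add_mul, map_add, map_add, h1, h2, map_add, map_add, map_add]; ring
  | ι_mul x m h =>
    rw [mul_assoc, contractLeft_ι_mul, contractLeft_ι_mul, map_sub, map_sub]
    have h1 := aug_ι_mul (R := R) m (contractLeft d (x * Y))
    have h2 := aug_ι_mul (R := R) m (contractLeft d x)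
    have h3 := aug_ι_mul (R := R) m x
    erw [h1, h2, h3]
    simp [mul_assoc]

theorem contract_even (d : Module.Dual R M) {X : ExteriorAlgebra R M}
    (hX : X ∈ evenOdd (0 : QuadraticForm R M) 0) :
    contractLeft d X ∈ evenOdd (0 : QuadraticForm R M) 1 := by
  induction X, hX using CliffordAlgebra.even_induction with
  | algebraMap r => simp
  | add x y hx hy h1 h2 => rw [map_add]; exact add_mem h1 h2
  | ι_mul_ι_mul m₁ m₂ x hx h =>
    rw [mul_assoc, contractLeft_ι_mul, contractLeft_ι_mul]
    have e1 : ι (0 : QuadraticForm R M) m₂ * x ∈ evenOdd (0 : QuadraticForm R M) 1 := by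
      simpa using SetLike.mul_mem_graded (ι_mem_evenOdd_one _ m₂) hx
    have e2 : ι (0 : QuadraticForm R M) m₁ * x ∈ evenOdd (0 : QuadraticForm R M) 1 := by
      simpa using SetLike.mul_mem_graded (ι_mem_evenOdd_one _ m₁) hx
    have e3 : ι (0 : QuadraticForm R M) m₁ * (ι (0 : QuadraticForm R M) m₂ * contractLeft d x) ∈
        evenOdd (0 : QuadraticForm R M) 1 := by
      rw [← mul_assoc]
      simpa using SetLike.mul_mem_graded (ι_mul_ι_mem_evenOdd_zero _ m₁ m₂) h
    rw [mul_sub, mul_smul_comm]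
    exact sub_mem (Submodule.smul_mem _ _ e1) (sub_mem (Submodule.smul_mem _ _ e2) e3)

theorem aug_contract_contract (d d' : Module.Dual R M) {X Y : ExteriorAlgebra R M}
    (hX : X ∈ evenOdd (0 : QuadraticForm R M) 1) (hY : Y ∈ evenOdd (0 : QuadraticForm R M) 1) :
    aug (contractLeft d' (contractLeft d (X * Y))) =
      aug (contractLeft d X) * aug (contractLeft d' Y) -
        aug (contractLeft d' X) * aug (contractLeft d Y) := by
  rw [contract_odd_mul d hX, map_sub, map_sub, aug_contract_mul, aug_contract_mul, aug_odd hX,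
    aug_odd hY]
  ring

theorem ev_contract_contract {𝕜 : Type*} [Field 𝕜] [Algebra 𝕜 R] (ev : R →ₐ[𝕜] 𝕜) (d d' : Module.Dual R M)
    {X Y : ExteriorAlgebra R M}
    (hX : X ∈ evenOdd (0 : QuadraticForm R M) 1) (hY : Y ∈ evenOdd (0 : QuadraticForm R M) 1) :
    ev (aug (contractLeft d' (contractLeft d (X * Y)))) =
      ev (aug (contractLeft d X)) * ev (aug (contractLeft d' Y)) -
        ev (aug (contractLeft d' X)) * ev (aug (contractLeft d Y)) := by
  rw [aug_contract_contract d d' hX hY, map_sub, map_mul, map_mul]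

/-- The subgroup generated by products of two odd elements. -/
def oddProducts (R M : Type*) [CommRing R] [AddCommGroup M] [Module R M] :
    AddSubgroup (ExteriorAlgebra R M) :=
  AddSubgroup.closure {Z | ∃ A ∈ evenOdd (0 : QuadraticForm R M) 1,
    ∃ B ∈ evenOdd (0 : QuadraticForm R M) 1, Z = A * B}

theorem even_sub_aug_mem {X : ExteriorAlgebra R M}
    (hX : X ∈ evenOdd (0 : QuadraticForm R M) 0) :
    X - algebraMap R _ (aug X) ∈ oddProducts R M := by
  induction X, hX using CliffordAlgebra.even_induction with
  | algebraMap r => simp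
  | add x y hx hy h1 h2 =>
    rw [map_add, map_add, add_sub_add_comm]; exact add_mem h1 h2
  | ι_mul_ι_mul m₁ m₂ x hx h =>
    have h1 := aug_ι_mul (R := R) m₁ (ι (0 : QuadraticForm R M) m₂ * x)
    rw [mul_assoc]
    erw [h1]
    rw [map_zero, sub_zero]
    exact AddSubgroup.subset_closure ⟨_, ι_mem_evenOdd_one _ m₁, _,
      by simpa using SetLike.mul_mem_graded (ι_mem_evenOdd_one _ m₂) hx, rfl⟩

theorem mem_oddProducts {X : ExteriorAlgebra R M}
    (hX : X ∈ evenOdd (0 : QuadraticForm R M) 0) (h0 : aug X = 0) : X ∈ oddProducts R M := by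
  have h := even_sub_aug_mem hX
  rwa [h0, map_zero, sub_zero] at h

/-- The covector on `Rⁿ` with the values of `V` on the generators as components. -/
def covec {𝕜 R : Type*} [Field 𝕜] [CommRing R] [Algebra 𝕜 R] {n : ℕ} (t : Fin n → 𝕜) :
    Module.Dual R (Fin n → R) :=
  ∑ a, algebraMap 𝕜 R (t a) • LinearMap.proj a

theorem derivation_eq {𝕜 R : Type*} [Field 𝕜] [CommRing R] [Algebra 𝕜 R] {n : ℕ} (ev : R →ₐ[𝕜] 𝕜)
    (V : ExteriorAlgebra R (Fin n → R) → 𝕜) (hadd : ∀ X Y, V (X + Y) = V X + V Y)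
    (h0 : ∀ r, V (algebraMap R _ r) = 0)
    (hmul : ∀ X Y, V (X * Y) = V X * ev (ExteriorAlgebra.algebraMapInv Y) +
      ev (ExteriorAlgebra.algebraMapInv X) * V Y) (X : ExteriorAlgebra R (Fin n → R)) :
    V X = ev (ExteriorAlgebra.algebraMapInv (contractLeft
      (covec (𝕜 := 𝕜) fun a => V (ExteriorAlgebra.ι R (Pi.single a 1))) X)) := by
  set d : Module.Dual R (Fin n → R) :=
    covec (𝕜 := 𝕜) fun a => V (ExteriorAlgebra.ι R (Pi.single a 1)) with hd
  have hι : ∀ m : Fin n → R, V (ExteriorAlgebra.ι R m) = ev (d m) := by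
    intro m
    let V' : ExteriorAlgebra R (Fin n → R) →+ 𝕜 := AddMonoidHom.mk' V hadd
    have hm : m = ∑ a, m a • Pi.single (M := fun _ => R) a 1 := by
      funext b
      simp [Finset.sum_apply, Pi.single_apply]
    have h1 : V (ExteriorAlgebra.ι R m) =
        ∑ a, V (algebraMap R _ (m a) * ExteriorAlgebra.ι R (Pi.single a 1)) := by
      change V' _ = ∑ a, V' _
      conv_lhs => rw [hm]
      simp only [map_sum, map_smul]
      simp only [Algebra.smul_def]
    rw [h1, hd]
    simp only [covec, LinearMap.sum_apply, LinearMap.smul_apply, LinearMap.proj_apply,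
      smul_eq_mul, map_sum, map_mul, hmul, h0]
    refine Finset.sum_congr rfl fun a _ => ?_
    simp [ExteriorAlgebra.algebraMapInv, mul_comm]
  induction X using CliffordAlgebra.left_induction with
  | algebraMap r =>
    rw [CliffordAlgebra.contractLeft_algebraMap, map_zero, map_zero]
    exact h0 r
  | add x y h1 h2 => rw [hadd, h1, h2, map_add, map_add, map_add]
  | ι_mul X m h =>
    have h4 := aug_ι_mul (R := R) m (contractLeft d X)
    have h5 := aug_ι_mul (R := R) m 1
    rw [mul_one] at h5
    have h6 := hmul (ExteriorAlgebra.ι R m) X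
    rw [h5, hι, map_zero, zero_mul, add_zero] at h6
    rw [contractLeft_ι_mul, map_sub, map_smul, smul_eq_mul]
    erw [h4]
    rw [sub_zero, map_mul]
    exact h6

end Contraction

namespace SuperSpace

variable {𝕜 : Type w} [Field 𝕜]

theorem secRes_secRes (S : SuperSpace.{u, v} 𝕜) {U V W : Opens S.red.top} (h : U ≤ V) (h' : V ≤ W)
    (x : sec S.O W) : secRes S.O h (secRes S.O h' x) = secRes S.O (h.trans h') x := by
  have := congrArg (fun k => k.hom x) (S.O.presheaf.map_comp (homOfLE h').op (homOfLE h).op)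
  exact this.symm

/-- The sections of the square of the ideal of odd functions generated by products of two odd
sections. -/
def oddSquare (S : SuperSpace.{u, v} 𝕜) (W : Opens S.red.top) : AddSubgroup (sec S.O W) :=
  AddSubgroup.closure {z | ∃ a ∈ S.odd W, ∃ b ∈ S.odd W, z = a * b}

namespace Chart

variable {S : SuperSpace.{u, v} 𝕜} {U : Opens S.red.top} {n : ℕ} (c : S.Chart U n)

/-- The odd coordinates `θ_a`. -/
def θ {W : Opens S.red.top} (hW : W ≤ U) (a : Fin n) : sec S.O W :=
  (c.iso W hW).symm (ExteriorAlgebra.ι (S.red.Fn W) (Pi.single a 1))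

/-- The inclusion of the regular functions on `W` into `𝒪_S(W)` given by the chart. -/
def incl {W : Opens S.red.top} (hW : W ≤ U) : S.red.Fn W →ₐ[𝕜] sec S.O W :=
  (c.iso W hW).symm.toAlgHom.comp (IsScalarTower.toAlgHom 𝕜 (S.red.Fn W) (Grassmann S.red n W))

theorem iso_incl {W : Opens S.red.top} (hW : W ≤ U) (f : S.red.Fn W) :
    c.iso W hW (c.incl hW f) = algebraMap (S.red.Fn W) (Grassmann S.red n W) f :=
  (c.iso W hW).apply_symm_apply _

theorem iso_θ {W : Opens S.red.top} (hW : W ≤ U) (a : Fin n) :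
    c.iso W hW (c.θ hW a) = ExteriorAlgebra.ι (S.red.Fn W) (Pi.single a 1) :=
  (c.iso W hW).apply_symm_apply _

theorem θ_odd {W : Opens S.red.top} (hW : W ≤ U) (a : Fin n) : c.θ hW a ∈ S.odd W := by
  rw [c.odd_iff hW, iso_θ]; exact CliffordAlgebra.ι_mem_evenOdd_one _ _

theorem incl_even {W : Opens S.red.top} (hW : W ≤ U) (f : S.red.Fn W) :
    c.incl hW f ∈ S.even W := by
  rw [c.even_iff hW, iso_incl]; exact SetLike.algebraMap_mem_graded _ _

theorem ε_incl {W : Opens S.red.top} (hW : W ≤ U) (f : S.red.Fn W) :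
    S.ε W (c.incl hW f) = f := by
  rw [c.ε_eq hW, iso_incl]; simp

theorem incl_res {W W' : Opens S.red.top} (h : W' ≤ W) (hW : W ≤ U) (f : S.red.Fn W) :
    c.incl (h.trans hW) (S.red.res h f) = secRes S.O h (c.incl hW f) := by
  apply (c.iso W' (h.trans hW)).injective
  rw [c.iso_res h hW, iso_incl, iso_incl, grassmannMap_algebraMap]; rfl

theorem θ_res {W W' : Opens S.red.top} (h : W' ≤ W) (hW : W ≤ U) (a : Fin n) :
    c.θ (h.trans hW) a = secRes S.O h (c.θ hW a) := by
  apply (c.iso W' (h.trans hW)).injective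
  rw [c.iso_res h hW, iso_θ, iso_θ, grassmannMap_ι]
  congr 1; funext b
  by_cases hb : b = a
  · subst hb; simp
  · simp [Pi.single_eq_of_ne hb]

theorem ε_odd (c : S.Chart U n) {W : Opens S.red.top} (hW : W ≤ U) {x : sec S.O W}
    (hx : x ∈ S.odd W) : S.ε W x = 0 := by
  rw [c.ε_eq hW]; exact aug_odd ((c.odd_iff hW x).1 hx)

/-- The covector on `𝒪(W)ⁿ` with the components of an odd tangent vector. -/
def covector {W : Opens S.red.top} (hW : W ≤ U) {p : S.red.top} (hp : p ∈ W)
    (v : S.oddTangent p) : Module.Dual (S.red.Fn W) (Fin n → S.red.Fn W) :=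
  covec fun a => v.1 ⟨W, hp⟩ (c.θ hW a)

theorem apply_eq {W : Opens S.red.top} (hW : W ≤ U) {p : S.red.top} (hp : p ∈ W)
    (v : S.oddTangent p) (x : sec S.O W) :
    v.1 ⟨W, hp⟩ x = S.red.evalAt hp (ExteriorAlgebra.algebraMapInv
      (CliffordAlgebra.contractLeft (c.covector hW hp v) (c.iso W hW x))) := by
  have h := derivation_eq (S.red.evalAt hp) (fun X => v.1 ⟨W, hp⟩ ((c.iso W hW).symm X))
    (fun X Y => by simp only [map_add])
    (fun r => v.2.2.2 ⟨W, hp⟩ _ (c.incl_even hW r))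
    (fun X Y => by
      have h1 := v.2.2.1 ⟨W, hp⟩ ((c.iso W hW).symm X) ((c.iso W hW).symm Y)
      have h2 : ∀ Z, S.ε W ((c.iso W hW).symm Z) = ExteriorAlgebra.algebraMapInv Z := fun Z => by
        rw [c.ε_eq hW, AlgEquiv.apply_symm_apply]
      simp only [map_mul]
      refine h1.trans ?_
      rw [← h2 X, ← h2 Y]) (c.iso W hW x)
  simp only [AlgEquiv.symm_apply_apply] at h
  exact h

end Chart

end SuperSpace

namespace SuperSpace

variable {𝕜 : Type w} [Field 𝕜]

theorem oddSquare_res (S : SuperSpace.{u, v} 𝕜) {W W' : Opens S.red.top} (h : W' ≤ W)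
    {x : sec S.O W} (hx : x ∈ S.oddSquare W) : secRes S.O h x ∈ S.oddSquare W' := by
  induction hx using AddSubgroup.closure_induction with
  | mem x hx =>
    obtain ⟨a, ha, b, hb, rfl⟩ := hx
    rw [map_mul]
    exact AddSubgroup.subset_closure ⟨_, S.res_odd h ha, _, S.res_odd h hb, rfl⟩
  | zero => rw [map_zero]; exact zero_mem _
  | add x y _ _ h1 h2 => rw [map_add]; exact add_mem h1 h2
  | neg x _ h1 => rw [map_neg]; exact neg_mem h1

theorem oddSquare_mul (S : SuperSpace.{u, v} 𝕜) {W : Opens S.red.top}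
    {x y : sec S.O W} (hx : x ∈ S.oddSquare W) (hy : y ∈ S.even W) :
    x * y ∈ S.oddSquare W := by
  induction hx using AddSubgroup.closure_induction with
  | mem x hx =>
    obtain ⟨a, ha, b, hb, rfl⟩ := hx
    rw [mul_assoc]
    refine AddSubgroup.subset_closure ⟨_, ha, _, ?_, rfl⟩
    rw [← S.even_comm hy]
    exact S.even_mul_odd hy hb
  | zero => rw [zero_mul]; exact zero_mem _
  | add x y _ _ h1 h2 => rw [add_mul]; exact add_mem h1 h2
  | neg x _ h1 => rw [neg_mul]; exact neg_mem h1

namespace Chart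

variable {S : SuperSpace.{u, v} 𝕜} {U : Opens S.red.top} {n : ℕ} (c : S.Chart U n)

theorem mem_oddSquare (c : S.Chart U n) {W : Opens S.red.top} (hW : W ≤ U) {x : sec S.O W}
    (hx : x ∈ S.even W) (h0 : S.ε W x = 0) : x ∈ S.oddSquare W := by
  have h1 : c.iso W hW x ∈ oddProducts _ _ :=
    mem_oddProducts ((c.even_iff hW x).1 hx) ((c.ε_eq hW x).symm.trans h0)
  have h2 : ∀ X ∈ oddProducts (S.red.Fn W) (Fin n → S.red.Fn W),
      (c.iso W hW).symm X ∈ S.oddSquare W := by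
    intro X hX
    induction hX using AddSubgroup.closure_induction with
    | mem X hX =>
      obtain ⟨A, hA, B, hB, rfl⟩ := hX
      rw [map_mul]
      refine AddSubgroup.subset_closure ⟨_, ?_, _, ?_, rfl⟩
      · rw [c.odd_iff hW, AlgEquiv.apply_symm_apply]; exact hA
      · rw [c.odd_iff hW, AlgEquiv.apply_symm_apply]; exact hB
    | zero => rw [map_zero]; exact zero_mem _
    | add x y _ _ h1 h2 => rw [map_add]; exact add_mem h1 h2
    | neg x _ h1 => rw [map_neg]; exact neg_mem h1
  have h3 := h2 _ h1
  rwa [AlgEquiv.symm_apply_apply] at h3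

/-- The pairing of the quadratic part of `x` (in the odd coordinates of the chart) with `v ∧ w`,
at the point `p`. -/
def pairing {W : Opens S.red.top} (hW : W ≤ U) {p : S.red.top} (hp : p ∈ W)
    (v w : S.oddTangent p) : sec S.O W →ₗ[𝕜] 𝕜 :=
  (S.red.evalAt hp).toLinearMap ∘ₗ
    (ExteriorAlgebra.algebraMapInv (R := S.red.Fn W)
      (M := Fin n → S.red.Fn W)).toLinearMap.restrictScalars 𝕜 ∘ₗ
    (CliffordAlgebra.contractLeft (Q := (0 : QuadraticForm (S.red.Fn W) (Fin n → S.red.Fn W)))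
      (c.covector hW hp w)).restrictScalars 𝕜 ∘ₗ
    (CliffordAlgebra.contractLeft (Q := (0 : QuadraticForm (S.red.Fn W) (Fin n → S.red.Fn W)))
      (c.covector hW hp v)).restrictScalars 𝕜 ∘ₗ
    (c.iso W hW).toLinearMap

theorem pairing_mul {W : Opens S.red.top} (hW : W ≤ U) {p : S.red.top} (hp : p ∈ W)
    (v w : S.oddTangent p) {a b : sec S.O W} (ha : a ∈ S.odd W) (hb : b ∈ S.odd W) :
    c.pairing hW hp v w (a * b) =
      v.1 ⟨W, hp⟩ a * w.1 ⟨W, hp⟩ b - w.1 ⟨W, hp⟩ a * v.1 ⟨W, hp⟩ b := by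
  have h := ev_contract_contract (S.red.evalAt hp) (c.covector hW hp v)
    (c.covector hW hp w) ((c.odd_iff hW a).1 ha) ((c.odd_iff hW b).1 hb)
  rw [c.apply_eq hW hp v, c.apply_eq hW hp v, c.apply_eq hW hp w, c.apply_eq hW hp w]
  refine Eq.trans ?_ h
  exact congrArg (fun Z => S.red.evalAt hp (ExteriorAlgebra.algebraMapInv
    (CliffordAlgebra.contractLeft (c.covector hW hp w)
      (CliffordAlgebra.contractLeft (c.covector hW hp v) Z)))) (map_mul (c.iso W hW) a b)

/-- On the square of the odd ideal, the pairing does not depend on the chart. -/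
theorem pairing_eq {U' : Opens S.red.top} {n' : ℕ} (c' : S.Chart U' n')
    {W W' : Opens S.red.top} (hW : W ≤ U) (hW' : W' ≤ U') (h : W' ≤ W) {p : S.red.top}
    (hp : p ∈ W') (v w : S.oddTangent p) {x : sec S.O W} (hx : x ∈ S.oddSquare W) :
    c.pairing hW (h hp) v w x = c'.pairing hW' hp v w (secRes S.O h x) := by
  induction hx using AddSubgroup.closure_induction with
  | mem x hx =>
    obtain ⟨a, ha, b, hb, rfl⟩ := hx
    rw [map_mul (secRes S.O h), pairing_mul _ _ _ _ _ ha hb,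
      pairing_mul _ _ _ _ _ (S.res_odd h ha) (S.res_odd h hb),
      v.2.1 ⟨W', hp⟩ ⟨W, h hp⟩ h a, v.2.1 ⟨W', hp⟩ ⟨W, h hp⟩ h b,
      w.2.1 ⟨W', hp⟩ ⟨W, h hp⟩ h a, w.2.1 ⟨W', hp⟩ ⟨W, h hp⟩ h b]
  | zero => rw [map_zero, map_zero, map_zero]
  | add x y _ _ h1 h2 => rw [map_add, h1, h2, map_add, map_add]
  | neg x _ h1 => rw [map_neg, h1, map_neg, map_neg]

theorem pairing_mul_even {W : Opens S.red.top} (hW : W ≤ U) {p : S.red.top} (hp : p ∈ W)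
    (v w : S.oddTangent p) {x y : sec S.O W} (hx : x ∈ S.oddSquare W) (hy : y ∈ S.even W) :
    c.pairing hW hp v w (x * y) = S.red.evalAt hp (S.ε W y) * c.pairing hW hp v w x := by
  induction hx using AddSubgroup.closure_induction with
  | mem x hx =>
    obtain ⟨a, ha, b, hb, rfl⟩ := hx
    have key : ∀ u : S.oddTangent p,
        u.1 ⟨W, hp⟩ (b * y) = u.1 ⟨W, hp⟩ b * S.red.evalAt hp (S.ε W y) := fun u => by
      have h1 := u.2.2.1 ⟨W, hp⟩ b y
      have h2 := u.2.2.2 ⟨W, hp⟩ y hy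
      rw [h1, h2, mul_zero, add_zero]
    have hby : b * y ∈ S.odd W := by rw [← S.even_comm hy]; exact S.even_mul_odd hy hb
    rw [mul_assoc, pairing_mul _ _ _ _ _ ha hby, pairing_mul _ _ _ _ _ ha hb, key, key]
    ring
  | zero => rw [zero_mul, map_zero, mul_zero]
  | add x y _ _ h1 h2 => rw [add_mul, map_add, h1, h2, map_add, mul_add]
  | neg x _ h1 => rw [neg_mul, map_neg, h1, map_neg, mul_neg]

theorem pairing_regular {W : Opens S.red.top} (hW : W ≤ U) {W' : Opens S.red.top} (h : W' ≤ W)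
    {v w : ∀ q : W', S.oddTangent q.1} (hv : S.IsOddField v) (hw : S.IsOddField w)
    {x : sec S.O W} (hx : x ∈ S.oddSquare W) :
    (fun q : W' => c.pairing hW (h q.2) (v q) (w q) x) ∈ S.red.fn W' := by
  induction hx using AddSubgroup.closure_induction with
  | mem x hx =>
    obtain ⟨a, ha, b, hb, rfl⟩ := hx
    simp only [pairing_mul _ _ _ _ _ ha hb]
    have key : ∀ (u : ∀ q : W', S.oddTangent q.1) (_ : S.IsOddField u) (z : sec S.O W),
        (fun q : W' => (u q).1 ⟨W, h q.2⟩ z) ∈ S.red.fn W' := by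
      intro u hu z
      have h1 := hu W' le_rfl (secRes S.O h z)
      have h2 : (fun q : W' => (u q).1 ⟨W, h q.2⟩ z) =
          fun q : W' => (u q).1 ⟨W', q.2⟩ (secRes S.O h z) := by
        funext q
        exact ((u q).2.1 ⟨W', q.2⟩ ⟨W, h q.2⟩ h z).symm
      rw [h2]
      exact h1
    exact sub_mem (mul_mem (key v hv a) (key w hw b)) (mul_mem (key w hw a) (key v hv b))
  | zero => simp only [map_zero]; exact zero_mem _
  | add x y _ _ h1 h2 => simp only [map_add]; exact add_mem h1 h2
  | neg x _ h1 => simp only [map_neg]; exact neg_mem h1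

theorem pairing_add_left {W : Opens S.red.top} (hW : W ≤ U) {p : S.red.top} (hp : p ∈ W)
    (v v' w : S.oddTangent p) {x : sec S.O W} (hx : x ∈ S.oddSquare W) :
    c.pairing hW hp (v + v') w x = c.pairing hW hp v w x + c.pairing hW hp v' w x := by
  induction hx using AddSubgroup.closure_induction with
  | mem x hx =>
    obtain ⟨a, ha, b, hb, rfl⟩ := hx
    simp only [pairing_mul _ _ _ _ _ ha hb, Submodule.coe_add, Pi.add_apply, LinearMap.add_apply]
    ring
  | zero => simp
  | add x y _ _ h1 h2 => rw [map_add, map_add, map_add, h1, h2]; ring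
  | neg x _ h1 => rw [map_neg, map_neg, map_neg, h1]; ring

theorem pairing_smul_left {W : Opens S.red.top} (hW : W ≤ U) {p : S.red.top} (hp : p ∈ W)
    (r : 𝕜) (v w : S.oddTangent p) {x : sec S.O W} (hx : x ∈ S.oddSquare W) :
    c.pairing hW hp (r • v) w x = r * c.pairing hW hp v w x := by
  induction hx using AddSubgroup.closure_induction with
  | mem x hx =>
    obtain ⟨a, ha, b, hb, rfl⟩ := hx
    simp only [pairing_mul _ _ _ _ _ ha hb, Submodule.coe_smul, Pi.smul_apply,
      LinearMap.smul_apply, smul_eq_mul]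
    ring
  | zero => simp
  | add x y _ _ h1 h2 => rw [map_add, map_add, h1, h2]; ring
  | neg x _ h1 => rw [map_neg, map_neg, h1]; ring

theorem pairing_swap {W : Opens S.red.top} (hW : W ≤ U) {p : S.red.top} (hp : p ∈ W)
    (v w : S.oddTangent p) {x : sec S.O W} (hx : x ∈ S.oddSquare W) :
    c.pairing hW hp v w x = -c.pairing hW hp w v x := by
  induction hx using AddSubgroup.closure_induction with
  | mem x hx =>
    obtain ⟨a, ha, b, hb, rfl⟩ := hx
    simp only [pairing_mul _ _ _ _ _ ha hb]
    ring
  | zero => simp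
  | add x y _ _ h1 h2 => rw [map_add, map_add, h1, h2]; ring
  | neg x _ h1 => rw [map_neg, map_neg, h1]

theorem pairing_self {W : Opens S.red.top} (hW : W ≤ U) {p : S.red.top} (hp : p ∈ W)
    (v : S.oddTangent p) {x : sec S.O W} (hx : x ∈ S.oddSquare W) :
    c.pairing hW hp v v x = 0 := by
  induction hx using AddSubgroup.closure_induction with
  | mem x hx =>
    obtain ⟨a, ha, b, hb, rfl⟩ := hx
    rw [pairing_mul _ _ _ _ _ ha hb, sub_self]
  | zero => simp
  | add x y _ _ h1 h2 => rw [map_add, h1, h2, add_zero]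
  | neg x _ h1 => rw [map_neg, h1, neg_zero]

/-- The difference on `W` of the inclusions of the regular functions given by two charts. -/
def inclDiff {U' : Opens S.red.top} {n' : ℕ} (c : S.Chart U n) (c' : S.Chart U' n')
    {W : Opens S.red.top} (hW : W ≤ U ⊓ U') : S.red.Fn W →ₗ[𝕜] sec S.O W :=
  (c'.incl (hW.trans inf_le_right)).toLinearMap - (c.incl (hW.trans inf_le_left)).toLinearMap

theorem inclDiff_mem {U' : Opens S.red.top} {n' : ℕ} (c' : S.Chart U' n')
    {W : Opens S.red.top} (hW : W ≤ U ⊓ U') (f : S.red.Fn W) :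
    c.inclDiff c' hW f ∈ S.oddSquare W := by
  refine c.mem_oddSquare (hW.trans inf_le_left) ?_ ?_
  · exact sub_mem (c'.incl_even _ f) (c.incl_even _ f)
  · change S.ε W (c'.incl _ f - c.incl _ f) = 0
    rw [map_sub, ε_incl, ε_incl, sub_self]

theorem inclDiff_res {U' : Opens S.red.top} {n' : ℕ} (c' : S.Chart U' n')
    {W W' : Opens S.red.top} (h : W' ≤ W) (hW : W ≤ U ⊓ U') (f : S.red.Fn W) :
    c.inclDiff c' (h.trans hW) (S.red.res h f) = secRes S.O h (c.inclDiff c' hW f) := by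
  change c'.incl _ _ - c.incl _ _ = secRes S.O h (c'.incl _ _ - c.incl _ _)
  rw [map_sub, ← c'.incl_res, ← c.incl_res]

theorem inclDiff_mul {U' : Opens S.red.top} {n' : ℕ} (c' : S.Chart U' n')
    {W : Opens S.red.top} (hW : W ≤ U ⊓ U') (f g : S.red.Fn W) :
    c.inclDiff c' hW (f * g) =
      c.inclDiff c' hW g * c.incl (hW.trans inf_le_left) f +
        c.inclDiff c' hW f * c'.incl (hW.trans inf_le_right) g := by
  change c'.incl _ (f * g) - c.incl _ (f * g) =
    (c'.incl _ g - c.incl _ g) * c.incl _ f + (c'.incl _ f - c.incl _ f) * c'.incl _ g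
  rw [map_mul, map_mul, sub_mul, sub_mul, S.even_comm (c'.incl_even _ g) (c.incl _ f),
    S.even_comm (c.incl_even _ g) (c.incl _ f)]
  abel

end Chart

end SuperSpace

/-! ### The sheaves `Hom(⋀² T₋S, T₊)` and the first obstruction class -/

/-- The alternating map given by an alternating bilinear function. -/
def alternatingOfBilinear {𝕜 E F : Type*} [Field 𝕜] [AddCommGroup E] [Module 𝕜 E] [AddCommGroup F]
    [Module 𝕜 F] (B : E → E → F) (hadd : ∀ v v' w, B (v + v') w = B v w + B v' w)
    (hsmul : ∀ (r : 𝕜) v w, B (r • v) w = r • B v w) (hswap : ∀ v w, B v w = -B w v)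
    (hself : ∀ v, B v v = 0) : E [⋀^Fin 2]→ₗ[𝕜] F where
  toFun t := B (t 0) (t 1)
  map_update_add' := by
    intro _ t i v w
    fin_cases i
    · simp [hadd]
    · simp [hswap (t 0), hadd]; abel
  map_update_smul' := by
    intro _ t i r v
    fin_cases i
    · simp [hsmul]
    · simp [hswap (t 0), hsmul]
  map_eq_zero_of_eq' := by
    intro t i j hij hne
    have h01 : t 0 = t 1 := by
      fin_cases i <;> fin_cases j <;> first | exact absurd rfl hne | exact hij | exact hij.symm
    change B (t 0) (t 1) = 0
    rw [h01, hself]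

namespace SuperSpace

variable {𝕜 : Type w} [Field 𝕜]

instance (X : FunctionSpace.{u} 𝕜) (p : X.top) : AddCommGroup (X.tangent p) :=
  Submodule.addCommGroup (X.tangent p)

instance (S : SuperSpace.{u, v} 𝕜) (p : S.red.top) : AddCommGroup (S.oddTangent p) :=
  Submodule.addCommGroup (S.oddTangent p)

/-- The fibre at `q` of `Hom(⋀² T₋S, φ^* T Y)`, where `φ` maps the reduced space of `S` to `Y`:
alternating bilinear maps from odd tangent vectors of `S` at `q` to tangent vectors of `Y` at
`φ(q)`. -/
abbrev HomFibre (S : SuperSpace.{u, v} 𝕜) {Y : FunctionSpace.{u} 𝕜}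
    (φ : FunctionSpace.Hom S.red Y) (q : S.red.top) :=
  (S.oddTangent q) [⋀^Fin 2]→ₗ[𝕜] (Y.tangent (φ.toTop q))

/-- The sections over `W` of `Hom(⋀² T₋S, φ^* T Y)`: the families of elements of the fibres that
map pairs of sections of `T₋S` to sections of `φ^* T Y`, that is, to families of tangent vectors
of `Y` whose application to any regular function on `Y` is a regular function on `S.red`. -/
def homSections (S : SuperSpace.{u, v} 𝕜) {Y : FunctionSpace.{u} 𝕜}
    (φ : FunctionSpace.Hom S.red Y) (W : Opens S.red.top) :
    AddSubgroup (∀ q : W, S.HomFibre φ q.1) where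
  carrier := {B | ∀ (W' : Opens S.red.top) (h : W' ≤ W) (v w : ∀ q : W', S.oddTangent q.1),
    S.IsOddField v → S.IsOddField w →
    ∀ (V : Opens Y.top) (hV : W' ≤ (Opens.map φ.toTop).obj V) (g : Y.Fn V),
      (fun q : W' => (B ⟨q.1, h q.2⟩ ![v q, w q]).1 ⟨V, hV q.2⟩ g) ∈ S.red.fn W'}
  zero_mem' := fun W' _ _ _ _ _ _ _ _ => zero_mem (S.red.fn W')
  add_mem' := fun hB hB' W' h v w hv hw V hV g =>
    add_mem (hB W' h v w hv hw V hV g) (hB' W' h v w hv hw V hV g)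
  neg_mem' := fun hB W' h v w hv hw V hV g => neg_mem (hB W' h v w hv hw V hV g)

/-- The sheaf `Hom(⋀² T₋S, φ^* T Y)` of abelian groups on the reduced space of `S`. -/
def homSheaf (S : SuperSpace.{u, v} 𝕜) {Y : FunctionSpace.{u} 𝕜}
    (φ : FunctionSpace.Hom S.red Y) : S.red.top.Presheaf AddCommGrpCat.{max u v w} where
  obj W := AddCommGrpCat.of (S.homSections φ W.unop)
  map i := AddCommGrpCat.ofHom
    { toFun := fun B => ⟨fun q => B.1 ⟨q.1, i.unop.le q.2⟩,
        fun W'' h v w hv hw V hV g => B.2 W'' (h.trans i.unop.le) v w hv hw V hV g⟩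
      map_zero' := rfl
      map_add' := fun _ _ => rfl }
  map_id _ := rfl
  map_comp _ _ := rfl

/-- The sheaf `Hom(⋀² T₋S, T₊S)`, where `T₊S` is the tangent bundle of the reduced space. -/
abbrev homSheafSelf (S : SuperSpace.{u, v} 𝕜) : S.red.top.Presheaf AddCommGrpCat.{max u v w} :=
  S.homSheaf (FunctionSpace.Hom.id S.red)

namespace Chart

variable {S : SuperSpace.{u, v} 𝕜} {U U' : Opens S.red.top} {n n' : ℕ}

/-- Over the intersection of two charts, the leading term (the class modulo the cube of the odd
ideal) of the transition automorphism between them: a regular function `g` in the second chart is,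
in terms of the first chart, `g + D(g)` modulo the cube of the odd ideal, where `D` is a derivation
with values in `⋀² T₋^∨`; the value of the leading term on `v ∧ w` is the derivation
`g ↦ ⟨D(g), v ∧ w⟩` at `q`. -/
def leadingValue (c : S.Chart U n) (c' : S.Chart U' n') {q : S.red.top} (hq : q ∈ U ⊓ U')
    (v w : S.oddTangent q) : S.red.tangent q :=
  ⟨fun V : OpenNhdsOf q =>
      c.pairing (W := V.toOpens ⊓ (U ⊓ U')) (inf_le_right.trans inf_le_left) ⟨V.mem, hq⟩ v w ∘ₗ
        c.inclDiff c' inf_le_right ∘ₗ (S.red.res inf_le_left).toLinearMap,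
    by
      refine ⟨fun V V' h f => ?_, fun V f g => ?_⟩
      · have hle : V.toOpens ⊓ (U ⊓ U') ≤ V'.toOpens ⊓ (U ⊓ U') := inf_le_inf_right _ h
        have h1 := c.inclDiff_res c' hle inf_le_right (S.red.res inf_le_left f)
        have h2 := c.pairing_eq c (inf_le_right.trans inf_le_left)
          (inf_le_right.trans inf_le_left) hle (p := q) ⟨V.mem, hq⟩ v w
          (c.inclDiff_mem c' inf_le_right (S.red.res inf_le_left f))
        refine Eq.trans ?_ h2.symm
        rw [← h1]
        rfl
      · have h1 := c.inclDiff_mul c' (W := V.toOpens ⊓ (U ⊓ U')) inf_le_right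
          (S.red.res inf_le_left f) (S.red.res inf_le_left g)
        rw [← map_mul] at h1
        refine (congrArg (c.pairing (W := V.toOpens ⊓ (U ⊓ U')) (inf_le_right.trans inf_le_left)
          ⟨V.mem, hq⟩ v w) h1).trans ?_
        refine (map_add _ _ _).trans (congrArg₂ (· + ·) ?_ ?_)
        · refine (c.pairing_mul_even _ _ v w (c.inclDiff_mem c' _ _) (c.incl_even _ _)).trans ?_
          rw [ε_incl]
          rfl
        · refine (c.pairing_mul_even _ _ v w (c.inclDiff_mem c' _ _) (c'.incl_even _ _)).trans ?_
          rw [ε_incl]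
          rfl⟩

theorem leadingValue_add (c : S.Chart U n) (c' : S.Chart U' n') {q : S.red.top} (hq : q ∈ U ⊓ U')
    (v v' w : S.oddTangent q) :
    c.leadingValue c' hq (v + v') w = c.leadingValue c' hq v w + c.leadingValue c' hq v' w := by
  apply Subtype.ext; funext V; apply LinearMap.ext; intro f
  exact c.pairing_add_left _ _ v v' w (c.inclDiff_mem c' inf_le_right (S.red.res inf_le_left f))

theorem leadingValue_smul (c : S.Chart U n) (c' : S.Chart U' n') {q : S.red.top} (hq : q ∈ U ⊓ U')
    (r : 𝕜) (v w : S.oddTangent q) :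
    c.leadingValue c' hq (r • v) w = r • c.leadingValue c' hq v w := by
  apply Subtype.ext; funext V; apply LinearMap.ext; intro f
  exact c.pairing_smul_left _ _ r v w (c.inclDiff_mem c' inf_le_right (S.red.res inf_le_left f))

theorem leadingValue_swap (c : S.Chart U n) (c' : S.Chart U' n') {q : S.red.top} (hq : q ∈ U ⊓ U')
    (v w : S.oddTangent q) : c.leadingValue c' hq v w = -c.leadingValue c' hq w v := by
  apply Subtype.ext; funext V; apply LinearMap.ext; intro f
  exact c.pairing_swap _ _ v w (c.inclDiff_mem c' inf_le_right (S.red.res inf_le_left f))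

theorem leadingValue_self (c : S.Chart U n) (c' : S.Chart U' n') {q : S.red.top} (hq : q ∈ U ⊓ U')
    (v : S.oddTangent q) : c.leadingValue c' hq v v = 0 := by
  apply Subtype.ext; funext V; apply LinearMap.ext; intro f
  exact c.pairing_self _ _ v (c.inclDiff_mem c' inf_le_right (S.red.res inf_le_left f))

/-- The leading term at `q` of the transition between two charts. -/
def leadingTermAt (c : S.Chart U n) (c' : S.Chart U' n') {q : S.red.top} (hq : q ∈ U ⊓ U') :
    (S.oddTangent q) [⋀^Fin 2]→ₗ[𝕜] (S.red.tangent q) :=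
  alternatingOfBilinear (c.leadingValue c' hq) (c.leadingValue_add c' hq)
    (c.leadingValue_smul c' hq) (c.leadingValue_swap c' hq) (c.leadingValue_self c' hq)

theorem leadingTermAt_apply (c : S.Chart U n) (c' : S.Chart U' n') {q : S.red.top}
    (hq : q ∈ U ⊓ U') (v w : S.oddTangent q) :
    c.leadingTermAt c' hq ![v, w] = c.leadingValue c' hq v w := rfl

theorem leadingValue_regular (c : S.Chart U n) (c' : S.Chart U' n') {W' : Opens S.red.top}
    (h : W' ≤ U ⊓ U') {v w : ∀ q : W', S.oddTangent q.1} (hv : S.IsOddField v)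
    (hw : S.IsOddField w) {V : Opens S.red.top} (hV : W' ≤ V) (g : S.red.Fn V) :
    (fun q : W' => (c.leadingValue c' (h q.2) (v q) (w q)).1 ⟨V, hV q.2⟩ g) ∈ S.red.fn W' := by
  have hx := c.pairing_regular (W := V ⊓ (U ⊓ U')) (inf_le_right.trans inf_le_left) (le_inf hV h)
      hv hw (c.inclDiff_mem c' inf_le_right (S.red.res inf_le_left g))
  have e : ∀ q : W', (c.leadingValue c' (h q.2) (v q) (w q)).1 ⟨V, hV q.2⟩ g =
      c.pairing (W := V ⊓ (U ⊓ U')) (inf_le_right.trans inf_le_left) (le_inf hV h q.2) (v q) (w q)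
      (c.inclDiff c' inf_le_right (S.red.res inf_le_left g)) := fun q => rfl
  simp only [e]
  exact hx

/-- The leading term of the transition between two charts, as a section of `Hom(⋀² T₋S, T₊S)`. -/
def leadingTerm (c : S.Chart U n) (c' : S.Chart U' n') :
    S.homSections (FunctionSpace.Hom.id S.red) (U ⊓ U') :=
  ⟨fun q => c.leadingTermAt c' q.2, fun _ h _ _ hv hw _ hV g =>
    c.leadingValue_regular c' h hv hw hV g⟩

theorem leadingTermAt_add {U'' : Opens S.red.top} {n'' : ℕ} (c : S.Chart U n) (c' : S.Chart U' n')
    (c'' : S.Chart U'' n'') {q : S.red.top} (hq : q ∈ U) (hq' : q ∈ U') (hq'' : q ∈ U'') :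
    c.leadingTermAt c' ⟨hq, hq'⟩ + c'.leadingTermAt c'' ⟨hq', hq''⟩ =
      c.leadingTermAt c'' ⟨hq, hq''⟩ := by
  apply AlternatingMap.ext; intro t
  apply Subtype.ext; funext V; apply LinearMap.ext; intro f
  let N : Opens S.red.top := V.toOpens ⊓ (U ⊓ U' ⊓ U'')
  have hqN : q ∈ N := ⟨V.mem, ⟨hq, hq'⟩, hq''⟩
  have hNU : N ≤ U := inf_le_right.trans (inf_le_left.trans inf_le_left)
  have hNU' : N ≤ U' := inf_le_right.trans (inf_le_left.trans inf_le_right)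
  have hNU'' : N ≤ U'' := inf_le_right.trans inf_le_right
  have key : ∀ {A B : Opens S.red.top} {m k : ℕ} (d : S.Chart A m) (d' : S.Chart B k)
      (hA : N ≤ A) (hB : N ≤ B),
      (d.leadingTermAt d' ⟨hA hqN, hB hqN⟩ t).1 V f =
        c.pairing hNU hqN (t 0) (t 1)
          (d'.incl hB (S.red.res inf_le_left f) - d.incl hA (S.red.res inf_le_left f)) := by
    intro A B m k d d' hA hB
    have hle : N ≤ V.toOpens ⊓ (A ⊓ B) := le_inf inf_le_left (le_inf hA hB)
    have h2 := d.pairing_eq c (inf_le_right.trans inf_le_left) hNU hle hqN (t 0) (t 1)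
      (d.inclDiff_mem d' inf_le_right (S.red.res inf_le_left f))
    have h1 := d.inclDiff_res d' hle inf_le_right (S.red.res inf_le_left f)
    refine Eq.trans h2 ?_
    rw [← h1]
    rfl
  refine Eq.trans (congrArg₂ (· + ·) (key c c' hNU hNU') (key c' c'' hNU' hNU'')) ?_
  refine Eq.trans ?_ (key c c'' hNU hNU'').symm
  rw [← map_add]
  congr 1
  abel

end Chart

end SuperSpace

namespace Supermanifold

variable {𝕜 : Type w} [RCLike 𝕜] {g : Geometry} (S : Supermanifold.{u, v} 𝕜 g)

/-- A domain of a chart around `p`. -/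
def chartDomain (p : S.red.top) : Opens S.red.top := (S.exists_chart p).choose

/-- The odd dimension at `p`. -/
def oddDim (p : S.red.top) : ℕ := (S.exists_chart p).choose_spec.choose

theorem mem_chartDomain (p : S.red.top) : p ∈ S.chartDomain p :=
  (S.exists_chart p).choose_spec.choose_spec.1

/-- A chart around `p`. -/
def chartAt (p : S.red.top) : S.Chart (S.chartDomain p) (S.oddDim p) :=
  (S.exists_chart p).choose_spec.choose_spec.2.some

/-- The cover by the domains of the charts. -/
def chartCover : PointCover S.red.top :=
  fun p => OrderDual.toDual ⟨S.chartDomain p, S.mem_chartDomain p⟩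

/-- The cocycle of the leading terms of the transition automorphisms. -/
def obstructionCocycle : cocycles S.homSheafSelf S.chartCover :=
  ⟨fun p p' => (S.chartAt p).leadingTerm (S.chartAt p'), fun p p' p'' => by
    apply Subtype.ext
    funext q
    exact (S.chartAt p).leadingTermAt_add (S.chartAt p') (S.chartAt p'') q.2.1.1 q.2.1.2 q.2.2⟩

/-- The first obstruction class `ω₂(S) ∈ H¹(M, Hom(⋀² T₋S, T₊S))`: the image, under passage to the
leading terms of automorphisms, of the class of `S` as a form of the split supermanifold
`S(M, T₋S)`. (Another choice of charts changes the cocycle by a coboundary, the leading terms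
of the transitions between the old and the new charts.) -/
def omega2 : H1 S.homSheafSelf := H1.mk S.homSheafSelf S.chartCover S.obstructionCocycle

end Supermanifold

section Contraction

open CliffordAlgebra

theorem grassmannMap_contract {R R' : Type*} [CommRing R] [CommRing R'] (ρ : R →+* R') {n : ℕ}
    (a : Fin n) (X : ExteriorAlgebra R (Fin n → R)) :
    contractLeft (LinearMap.proj a) (grassmannMap ρ n X) =
      grassmannMap ρ n (contractLeft (LinearMap.proj a) X) := by
  induction X using CliffordAlgebra.left_induction with
  | algebraMap r =>
    have h := grassmannMap_algebraMap ρ n r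
    erw [h, contractLeft_algebraMap, contractLeft_algebraMap, map_zero]
  | add x y h1 h2 => rw [map_add, map_add, h1, h2, map_add, map_add]
  | ι_mul X m h =>
    have h3 := grassmannMap_ι ρ n m
    rw [map_mul]
    erw [h3, contractLeft_ι_mul]
    rw [contractLeft_ι_mul, map_sub, map_mul, h]
    erw [h3]
    rw [Algebra.smul_def, Algebra.smul_def, map_mul]
    erw [grassmannMap_algebraMap ρ n]
    rfl

theorem aug_grassmannMap {R R' : Type*} [CommRing R] [CommRing R'] (ρ : R →+* R') {n : ℕ}
    (X : ExteriorAlgebra R (Fin n → R)) :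
    ExteriorAlgebra.algebraMapInv (grassmannMap ρ n X) = ρ (ExteriorAlgebra.algebraMapInv X) := by
  induction X using CliffordAlgebra.left_induction with
  | algebraMap r =>
    have h := grassmannMap_algebraMap ρ n r
    erw [h]
    erw [AlgHom.commutes, AlgHom.commutes]
    rfl
  | add x y h1 h2 => rw [map_add, map_add, h1, h2, map_add, map_add]
  | ι_mul X m h =>
    have h3 := grassmannMap_ι ρ n m
    have h4 := aug_ι_mul (R := R) m X
    have h5 := aug_ι_mul (R := R') (fun a => ρ (m a)) (grassmannMap ρ n X)
    rw [map_mul]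
    erw [h3, h4, h5, map_zero]

end Contraction

namespace SuperSpace

variable {𝕜 : Type w} [Field 𝕜]

namespace Chart

variable {S : SuperSpace.{u, v} 𝕜} {U : Opens S.red.top} {n : ℕ} (c : S.Chart U n)

/-- The regular function `∂x/∂θ_a` modulo odd functions. -/
def partialDeriv {W : Opens S.red.top} (hW : W ≤ U) (a : Fin n) : sec S.O W →ₗ[𝕜] S.red.Fn W :=
  (ExteriorAlgebra.algebraMapInv (R := S.red.Fn W)
      (M := Fin n → S.red.Fn W)).toLinearMap.restrictScalars 𝕜 ∘ₗ
    (CliffordAlgebra.contractLeft (Q := (0 : QuadraticForm (S.red.Fn W) (Fin n → S.red.Fn W)))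
      (LinearMap.proj a)).restrictScalars 𝕜 ∘ₗ
    (c.iso W hW).toLinearMap

theorem partialDeriv_res {W W' : Opens S.red.top} (h : W' ≤ W) (hW : W ≤ U) (a : Fin n)
    (x : sec S.O W) :
    c.partialDeriv (h.trans hW) a (secRes S.O h x) = S.red.res h (c.partialDeriv hW a x) := by
  change ExteriorAlgebra.algebraMapInv (CliffordAlgebra.contractLeft _ (c.iso W' _ _)) = _
  rw [c.iso_res h hW, grassmannMap_contract, aug_grassmannMap]
  rfl

theorem partialDeriv_mul {W : Opens S.red.top} (hW : W ≤ U) (a : Fin n) (x y : sec S.O W) :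
    c.partialDeriv hW a (x * y) =
      c.partialDeriv hW a x * S.ε W y + S.ε W x * c.partialDeriv hW a y := by
  have h := aug_contract_mul (LinearMap.proj a) (c.iso W hW x) (c.iso W hW y)
  rw [← map_mul] at h
  rw [c.ε_eq hW, c.ε_eq hW]
  exact h

theorem partialDeriv_even {W : Opens S.red.top} (hW : W ≤ U) (a : Fin n) {x : sec S.O W}
    (hx : x ∈ S.even W) : c.partialDeriv hW a x = 0 := by
  have h := aug_odd (contract_even (LinearMap.proj a) ((c.even_iff hW x).1 hx))
  exact h

/-- The odd tangent vector `∂/∂θ_a` at `q`. -/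
def frame (a : Fin n) {q : S.red.top} (hq : q ∈ U) : S.oddTangent q :=
  ⟨fun V => (S.red.evalAt (W := V.toOpens ⊓ U) ⟨V.mem, hq⟩).toLinearMap ∘ₗ
      c.partialDeriv inf_le_right a ∘ₗ (secRes S.O inf_le_left).toLinearMap, by
    refine ⟨fun V V' h x => ?_, fun V x y => ?_, fun V x hx => ?_⟩
    · have hle : V.toOpens ⊓ U ≤ V'.toOpens ⊓ U := inf_le_inf_right _ h
      have h1 := c.partialDeriv_res hle inf_le_right a (secRes S.O inf_le_left x)
      rw [secRes_secRes] at h1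
      change S.red.evalAt _ (c.partialDeriv _ a (secRes S.O _ (secRes S.O h x))) =
        S.red.evalAt _ (c.partialDeriv _ a (secRes S.O _ x))
      rw [secRes_secRes]
      exact congrArg (S.red.evalAt (W := V.toOpens ⊓ U) ⟨V.mem, hq⟩) h1
    · have h1 := c.partialDeriv_mul (W := V.toOpens ⊓ U) inf_le_right a
        (secRes S.O inf_le_left x) (secRes S.O inf_le_left y)
      rw [← map_mul, S.ε_res, S.ε_res] at h1
      refine (congrArg (S.red.evalAt (W := V.toOpens ⊓ U) ⟨V.mem, hq⟩) h1).trans ?_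
      rw [map_add, map_mul, map_mul]
      rfl
    · refine (congrArg (S.red.evalAt (W := V.toOpens ⊓ U) ⟨V.mem, hq⟩)
        (c.partialDeriv_even inf_le_right a (S.res_even inf_le_left hx))).trans ?_
      exact map_zero _⟩

theorem frame_apply (a : Fin n) {V : Opens S.red.top} (hV : V ≤ U) {q : S.red.top} (hq : q ∈ V)
    (x : sec S.O V) :
    (c.frame a (hV hq)).1 ⟨V, hq⟩ x = S.red.evalAt hq (c.partialDeriv hV a x) := by
  have h1 := c.partialDeriv_res (W' := V ⊓ U) inf_le_left hV a x
  exact congrArg (S.red.evalAt (W := V ⊓ U) ⟨hq, hV hq⟩) h1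

theorem frame_regular (a : Fin n) {W : Opens S.red.top} (hW : W ≤ U) :
    S.IsOddField (W := W) fun q => c.frame a (hW q.2) := by
  intro V h x
  have h1 : (fun q : V => (c.frame a (hW (h q.2))).1 ⟨V, q.2⟩ x) =
      (c.partialDeriv (h.trans hW) a x).1 := by
    funext q
    exact c.frame_apply a (h.trans hW) q.2 x
  rw [h1]
  exact (c.partialDeriv (h.trans hW) a x).2

theorem frame_expand {q : S.red.top} (hq : q ∈ U) (v : S.oddTangent q) :
    v = ∑ a, v.1 ⟨U, hq⟩ (c.θ le_rfl a) • c.frame a hq := by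
  apply Subtype.ext; funext V; apply LinearMap.ext; intro x
  have hqN : q ∈ V.toOpens ⊓ U := ⟨V.mem, hq⟩
  have h1 := v.2.1 ⟨V.toOpens ⊓ U, hqN⟩ V inf_le_left x
  have h2 := c.apply_eq (W := V.toOpens ⊓ U) inf_le_right hqN v (secRes S.O inf_le_left x)
  rw [← h1, h2]
  simp only [covector, covec, map_sum, LinearMap.sum_apply, map_smul, LinearMap.smul_apply,
    Submodule.coe_sum, Finset.sum_apply, Submodule.coe_smul, Pi.smul_apply, smul_eq_mul, map_mul]
  refine Finset.sum_congr rfl fun a _ => ?_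
  have h3 := v.2.1 ⟨V.toOpens ⊓ U, hqN⟩ ⟨U, hq⟩ inf_le_right (c.θ le_rfl a)
  rw [← c.θ_res] at h3
  refine congrArg₂ (· * ·) ?_ rfl
  exact (AlgHom.commutes _ _).trans h3

end Chart

end SuperSpace

/-! ### The comparison maps for a submanifold -/

namespace SuperSpace

variable {𝕜 : Type w} [Field 𝕜]

/-- The morphism of sheaves `j : Hom(⋀² T₋S', T₊S') → Hom(⋀² T₋S', f^* T₊S)` induced by the
differential of the map of reduced spaces. -/
def Hom.jSheaf {S' S : SuperSpace.{u, v} 𝕜} (f : Hom S' S) :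
    S'.homSheafSelf ⟶ S'.homSheaf f.red where
  app W := AddCommGrpCat.ofHom
    { toFun := fun B => ⟨fun q => (f.red.diff q.1).compAlternatingMap (B.1 q),
        fun W' h v w hv hw V hV g => B.2 W' h v w hv hw ((Opens.map f.red.toTop).obj V) hV
          (f.red.pull V g)⟩
      map_zero' := by
        apply Subtype.ext; funext q; apply AlternatingMap.ext; intro t
        exact map_zero (f.red.diff q.1)
      map_add' := fun B B' => by
        apply Subtype.ext; funext q; apply AlternatingMap.ext; intro t
        exact map_add (f.red.diff q.1) _ _ }
  naturality _ _ _ := rfl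

/-- The pull-back to the fibre at `q` of an element of the fibre at `f(q)`. -/
def Hom.pullFibre {S' S : SuperSpace.{u, v} 𝕜} (f : Hom S' S) (q : S'.red.top)
    (B : S.HomFibre (FunctionSpace.Hom.id S.red) (f.red.toTop q)) : S'.HomFibre f.red q :=
  AlternatingMap.compLinearMap (N := S.red.tangent (f.red.toTop q)) B (f.oddDiff q)

theorem alternating_expand {E F : Type*} [AddCommGroup E] [Module 𝕜 E] [AddCommGroup F]
    [Module 𝕜 F] (B : E [⋀^Fin 2]→ₗ[𝕜] F) {n : ℕ} (r s : Fin n → 𝕜) (e : Fin n → E) :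
    B ![∑ a, r a • e a, ∑ a, s a • e a] =
      ∑ k : Fin 2 → Fin n, (r (k 0) * s (k 1)) • B ![e (k 0), e (k 1)] := by
  have h1 : (![∑ a, r a • e a, ∑ a, s a • e a] : Fin 2 → E) =
      fun i => ∑ a, (![r, s] i a) • e a := by
    funext i; fin_cases i <;> rfl
  rw [h1, ← AlternatingMap.coe_multilinearMap, MultilinearMap.map_sum]
  refine Finset.sum_congr rfl fun k _ => ?_
  rw [MultilinearMap.map_smul_univ, Fin.prod_univ_two]
  have h2 : (![e (k 0), e (k 1)] : Fin 2 → E) = fun i => e (k i) := by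
    funext i; fin_cases i <;> rfl
  rw [h2]
  rfl

theorem IsOddField.regular_of_le {S : SuperSpace.{u, v} 𝕜} {W N V : Opens S.red.top}
    {v : ∀ q : W, S.oddTangent q.1} (hv : S.IsOddField v) (h : N ≤ W) (h' : N ≤ V)
    (x : sec S.O V) :
    (fun q : N => (v ⟨q.1, h q.2⟩).1 ⟨V, h' q.2⟩ x) ∈ S.red.fn N := by
  have h1 := hv N h (secRes S.O h' x)
  have h2 : ∀ q : N, (v ⟨q.1, h q.2⟩).1 ⟨N, q.2⟩ (secRes S.O h' x) =
      (v ⟨q.1, h q.2⟩).1 ⟨V, h' q.2⟩ x := fun q =>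
    (v ⟨q.1, h q.2⟩).2.1 ⟨N, q.2⟩ ⟨V, h' q.2⟩ h' x
  simp only [h2] at h1
  exact h1

end SuperSpace

namespace Supermanifold

variable {𝕜 : Type w} [RCLike 𝕜] {g : Geometry}

open SuperSpace

theorem pullFibre_regular {S' : SuperSpace.{u, v} 𝕜} (S : Supermanifold.{u, v} 𝕜 g)
    (f : SuperSpace.Hom S' S.toSuperSpace) {U : Opens S.red.top}
    (B : S.homSections (FunctionSpace.Hom.id S.red) U) :
    (fun q : ((Opens.map f.red.toTop).obj U : Opens S'.red.top) =>
      f.pullFibre q.1 (B.1 ⟨f.red.toTop q.1, q.2⟩)) ∈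
        S'.homSections f.red ((Opens.map f.red.toTop).obj U) := by
  intro W' h v w hv hw V hV G
  refine S'.red.local_mem _ fun q0 => ?_
  obtain ⟨U0, n, hq0, ⟨c⟩⟩ := S.exists_chart (f.red.toTop q0.1)
  let T : Opens S.red.top := U0 ⊓ U ⊓ V
  let N : Opens S'.red.top := W' ⊓ (Opens.map f.red.toTop).obj T
  have hNW : N ≤ W' := inf_le_left
  have hNT : N ≤ (Opens.map f.red.toTop).obj T := inf_le_right
  have hT0 : T ≤ U0 := inf_le_left.trans inf_le_left
  have hTU : T ≤ U := inf_le_left.trans inf_le_right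
  have hTV : T ≤ V := inf_le_right
  refine ⟨N, hNW, ⟨q0.2, ⟨hq0, h q0.2⟩, hV q0.2⟩, ?_⟩
  have hN0 : N ≤ (Opens.map f.red.toTop).obj U0 := fun _ hq => hT0 (hNT hq)
  have key : ∀ q : N,
      (f.pullFibre q.1 (B.1 ⟨f.red.toTop q.1, h (hNW q.2)⟩) ![v ⟨q.1, hNW q.2⟩, w ⟨q.1, hNW q.2⟩]).1
          ⟨V, hV (hNW q.2)⟩ G =
        ∑ k : Fin 2 → Fin n,
          ((v ⟨q.1, hNW q.2⟩).1 ⟨_, hN0 q.2⟩ (f.pull U0 (c.θ le_rfl (k 0))) *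
            (w ⟨q.1, hNW q.2⟩).1 ⟨_, hN0 q.2⟩ (f.pull U0 (c.θ le_rfl (k 1)))) *
          (B.1 ⟨f.red.toTop q.1, h (hNW q.2)⟩ ![c.frame (k 0) (hN0 q.2), c.frame (k 1) (hN0 q.2)]).1
            ⟨V, hV (hNW q.2)⟩ G := by
    intro q
    have h1 := c.frame_expand (hN0 q.2) (f.oddDiff q.1 (v ⟨q.1, hNW q.2⟩))
    have h2 := c.frame_expand (hN0 q.2) (f.oddDiff q.1 (w ⟨q.1, hNW q.2⟩))
    have h3 : (f.oddDiff q.1 ∘ ![v ⟨q.1, hNW q.2⟩, w ⟨q.1, hNW q.2⟩] :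
        Fin 2 → S.oddTangent (f.red.toTop q.1)) =
        ![f.oddDiff q.1 (v ⟨q.1, hNW q.2⟩), f.oddDiff q.1 (w ⟨q.1, hNW q.2⟩)] := by
      funext i; fin_cases i <;> rfl
    let B0 : (S.oddTangent (f.red.toTop q.1)) [⋀^Fin 2]→ₗ[𝕜] (S.red.tangent (f.red.toTop q.1)) :=
      B.1 ⟨f.red.toTop q.1, h (hNW q.2)⟩
    have h4 := congrArg B0 h3
    rw [h1, h2, alternating_expand] at h4
    have h5 := congrArg (fun t : S.red.tangent (f.red.toTop q.1) => t.1 ⟨V, hV (hNW q.2)⟩ G) h4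
    refine h5.trans ?_
    simp only [Submodule.coe_sum, Finset.sum_apply, LinearMap.sum_apply, Submodule.coe_smul,
      Pi.smul_apply, LinearMap.smul_apply, smul_eq_mul]
    rfl
  refine (congrArg (· ∈ S'.red.fn N) (funext key)).mpr ?_
  have hsum : ∀ (F : (Fin 2 → Fin n) → N → 𝕜), (∀ k, F k ∈ S'.red.fn N) →
      (fun q => ∑ k, F k q) ∈ S'.red.fn N := by
    intro F hF
    have := sum_mem (S := S'.red.fn N) (t := Finset.univ) fun k _ => hF k
    convert this using 1
    funext q
    simp
  refine hsum _ fun k => mul_mem (mul_mem ?_ ?_) ?_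
  · exact hv.regular_of_le hNW hN0 _
  · exact hw.regular_of_le hNW hN0 _
  · have h1 := B.2 T hTU (fun q => c.frame (k 0) (hT0 q.2)) (fun q => c.frame (k 1) (hT0 q.2))
      (c.frame_regular (k 0) hT0) (c.frame_regular (k 1) hT0) V hTV G
    exact S'.red.res_mem hNT _ (f.red.comp_mem T _ h1)

/-- The morphism of sheaves `ι : Hom(⋀² T₋S, T₊S) → f_* Hom(⋀² T₋S', f^* T₊S)` induced by
pull-back along `f` and the odd differential of `f`. -/
def ιSheaf {S' : SuperSpace.{u, v} 𝕜} (S : Supermanifold.{u, v} 𝕜 g)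
    (f : SuperSpace.Hom S' S.toSuperSpace) :
    S.homSheafSelf ⟶ (TopCat.Presheaf.pushforward _ f.red.toTop).obj (S'.homSheaf f.red) where
  app _ := AddCommGrpCat.ofHom
    { toFun := fun B => ⟨fun q => f.pullFibre q.1 (B.1 ⟨f.red.toTop q.1, q.2⟩),
        pullFibre_regular S f B⟩
      map_zero' := rfl
      map_add' := fun _ _ => rfl }
  naturality _ _ _ := rfl

end Supermanifold

namespace SuperSpace

variable {𝕜 : Type w} [Field 𝕜]

/-- The even normal sequence `0 → T M' → f^* T M → N → 0` of the map `f : M' → M` of reduced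
spaces splits: the differential `T M' → f^* T M` has a left inverse `r` that is a morphism of
sheaves of modules, given by a family of linear maps on the fibres that takes sections of
`f^* T M` to sections of `T M'`. -/
def Hom.NormalSequenceSplits {S' S : SuperSpace.{u, v} 𝕜} (f : Hom S' S) : Prop :=
  ∃ r : ∀ q : S'.red.top, S.red.tangent (f.red.toTop q) →ₗ[𝕜] S'.red.tangent q,
    (∀ q v, r q (f.red.diff q v) = v) ∧
    ∀ (W : Opens S'.red.top) (X : ∀ q : W, S.red.tangent (f.red.toTop q.1)),
      (∀ (W' : Opens S'.red.top) (h : W' ≤ W) (V : Opens S.red.top)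
        (hV : W' ≤ (Opens.map f.red.toTop).obj V) (g : S.red.Fn V),
        (fun q : W' => (X ⟨q.1, h q.2⟩).1 ⟨V, hV q.2⟩ g) ∈ S'.red.fn W') →
      ∀ (V : Opens S'.red.top) (h : V ≤ W) (g : S'.red.Fn V),
        (fun q : V => (r q.1 (X ⟨q.1, h q.2⟩)).1 ⟨V, q.2⟩ g) ∈ S'.red.fn V

end SuperSpace

end SuperGeometry

end

/-!
The comparison of the first obstruction classes of `S` and `S'` comes down to one additive identity.
Let `σ_p`, `σ'_p` be the inclusions of the regular functions into `𝒪_S`, `𝒪_S'` given by charts, and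
let `φ` be the map of reduced spaces underlying `f`. Regular functions on the reduced space of `S`
can be lifted to `𝒪_S'` in two ways, by `σ'_p ∘ φ^*` and by `f^♯ ∘ σ_{φ(p)}`. Both are local lifts of
`φ^*` to even algebra homomorphisms (`LocalLift`), and the difference of two such lifts, modulo the
cube of the odd ideal, is a section of `Hom(⋀² T₋S', φ^* T₊S)` (`liftDiff`). In these terms `j` of
the obstruction cocycle of `S'` is `σ'_q ∘ φ^* - σ'_p ∘ φ^*` (`Chart.leadingValue_localLift`), and
`ι` of the obstruction cocycle of `S` is `f^♯ ∘ σ_{φ(q)} - f^♯ ∘ σ_{φ(p)}`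
(`Hom.leadingValue_chartLift`), because pairing with `v ∧ w` commutes with `f^♯` on the square of the
odd ideal (`Hom.pairing_oddDiff`). So the two cocycles differ by the coboundary of
`p ↦ σ'_p ∘ φ^* - f^♯ ∘ σ_{φ(p)}` (`Supermanifold.map_omega2_eq_pull_omega2`).

A projection of `S` to its reduced space is a global lift `σ` of the identity, and then the
obstruction cocycle is the coboundary of `p ↦ σ_p - σ`
(`Supermanifold.omega2_eq_zero_of_isProjected`). Finally, a left inverse of `T M' → φ^* T M` induces
a left inverse of the map `j` on cohomology, so `ω₂(S') ≠ 0` forces `j(ω₂(S')) = ι(ω₂(S)) ≠ 0`.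
-/

namespace SuperGeometry

/-! ### Čech classes -/

section Cech

variable {X Y : TopCat.{u}}

open Classical in
theorem H1.mk_coboundary (A : X.Presheaf AddCommGrpCat.{w}) (𝒰 : PointCover X)
    (b : ∀ x : X, A.obj (op (𝒰.at x))) : H1.mk A 𝒰 (coboundary A 𝒰 b) = 0 := by
  have h : (QuotientAddGroup.mk' (coboundary A 𝒰).range) (coboundary A 𝒰 b) = 0 :=
    (QuotientAddGroup.eq_zero_iff _).2 ⟨b, rfl⟩
  exact (congrArg (AddCommGroup.DirectLimit.of (CechH1 A) (refineH1 A) 𝒰) h).trans (map_zero _)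

open Classical in
/-- The pull-back of a Čech class can be computed on any cover finer than the preimage of the given
one. -/
theorem H1.pull_mk (f : Y ⟶ X) {A : X.Presheaf AddCommGrpCat.{w}}
    {B : Y.Presheaf AddCommGrpCat.{w}}
    (φ : A ⟶ (TopCat.Presheaf.pushforward AddCommGrpCat.{w} f).obj B) (𝒰 : PointCover X)
    (𝒱 : PointCover Y) (h : ∀ y, 𝒱.at y ≤ (Opens.map f).obj (𝒰.at (f y))) (c : cocycles A 𝒰) :
    H1.pull f φ (H1.mk A 𝒰 c) = H1.mk B 𝒱 (pullCocycle f A B φ 𝒰 𝒱 h c) := by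
  have hle : 𝒰.comap f ≤ 𝒱 := fun y => h y
  have h1 : H1.pull f φ (H1.mk A 𝒰 c) =
      H1.mk B (𝒰.comap f) (pullCocycle f A B φ 𝒰 (𝒰.comap f) (fun _ => le_rfl) c) :=
    AddCommGroup.DirectLimit.lift_of _ _ _ _ _
  rw [h1]
  refine (AddCommGroup.DirectLimit.of_f (G := CechH1 B) (f := refineH1 B) hle _).symm.trans ?_
  refine congrArg (AddCommGroup.DirectLimit.of (CechH1 B) (refineH1 B) 𝒱) ?_
  refine congrArg (QuotientAddGroup.mk' (coboundary B 𝒱).range) ?_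
  apply Subtype.ext; funext y y'
  exact abRes_abRes B _ _ _

/-- A left inverse of a morphism of presheaves induces a left inverse on Čech classes. -/
theorem H1.map_map_mk {A B : X.Presheaf AddCommGrpCat.{w}} (α : A ⟶ B) (β : B ⟶ A)
    (h : α ≫ β = 𝟙 A) (𝒰 : PointCover X) (c : cocycles A 𝒰) :
    H1.map β (H1.map α (H1.mk A 𝒰 c)) = H1.mk A 𝒰 c := by
  unfold H1.map
  rw [H1.pull_mk (𝟙 X) (toPushforwardId α) 𝒰 𝒰 (fun _ => le_rfl),
    H1.pull_mk (𝟙 X) (toPushforwardId β) 𝒰 𝒰 (fun _ => le_rfl)]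
  congr 1
  apply Subtype.ext; funext x y
  have key : ∀ (F : X.Presheaf AddCommGrpCat.{w}) {U : Opens X} (hU : U ≤ U) (a : F.obj (op U)),
      abRes F hU a = a := fun F U hU a =>
    congrArg (fun k => k.hom a) (F.map_id (op U))
  refine (key A _ _).trans ?_
  refine (congrArg (β.app _).hom (key B _ _)).trans ?_
  exact congrArg (fun k => (k.app (op (𝒰.at x ⊓ 𝒰.at y))).hom (c.1 x y)) h

end Cech

namespace SuperSpace

variable {𝕜 : Type w} [Field 𝕜]

/-! ### Local lifts of regular functions -/

/-- A lift, over the open set `U` of the reduced space of `S`, of the pull-back of regular functions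
along `φ : S.red → Y` to a homomorphism of sheaves of `ℤ/2`-graded algebras with values in `𝒪_S`;
geometrically, an extension of `φ|_U` to a morphism of `S|_U` to the purely even space `Y`.
A homomorphism `φ⁻¹ 𝒪_Y → 𝒪_S|_U` is encoded by its values on the sections over the open sets `V`
of `Y`, restricted to open sets `W` of `U` that `φ` maps to `V`. -/
structure LocalLift (S : SuperSpace.{u, v} 𝕜) {Y : FunctionSpace.{u} 𝕜}
    (φ : FunctionSpace.Hom S.red Y) (U : Opens S.red.top) where
  lift : ∀ (V : Opens Y.top) (W : Opens S.red.top), W ≤ U → W ≤ (Opens.map φ.toTop).obj V →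
    (Y.Fn V →ₐ[𝕜] sec S.O W)
  lift_even : ∀ V W hU hV g, lift V W hU hV g ∈ S.even W
  ε_lift : ∀ V W hU hV g, S.ε W (lift V W hU hV g) = S.red.res hV (φ.pull V g)
  secRes_lift : ∀ V W W' (h : W' ≤ W) hU hV g,
    secRes S.O h (lift V W hU hV g) = lift V W' (h.trans hU) (h.trans hV) g
  lift_res : ∀ V V' W (h : V' ≤ V) hU hV hV' g,
    lift V' W hU hV' (Y.res h g) = lift V W hU hV g

variable {S : SuperSpace.{u, v} 𝕜} {Y : FunctionSpace.{u} 𝕜} {φ : FunctionSpace.Hom S.red Y}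
  {U U' U₀ : Opens S.red.top} {n n' : ℕ}

/-- The restriction of a lift to a smaller open set. -/
def LocalLift.restrict (L : S.LocalLift φ U) (h : U' ≤ U) : S.LocalLift φ U' where
  lift V W hU hV := L.lift V W (hU.trans h) hV
  lift_even V W _ _ g := L.lift_even V W _ _ g
  ε_lift V W _ _ g := L.ε_lift V W _ _ g
  secRes_lift V W W' h _ _ g := L.secRes_lift V W W' h _ _ g
  lift_res V V' W h _ _ _ g := L.lift_res V V' W h _ _ _ g

/-- The lift given by the inclusion of the regular functions in a chart. -/
def Chart.localLift (c : S.Chart U n) (φ : FunctionSpace.Hom S.red Y) : S.LocalLift φ U where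
  lift V _ hU hV := (c.incl hU).comp ((S.red.res hV).comp (φ.pull V))
  lift_even _ _ hU _ _ := c.incl_even hU _
  ε_lift _ _ hU _ _ := c.ε_incl hU _
  secRes_lift _ _ _ h hU _ _ := (c.incl_res h hU _).symm
  lift_res _ _ _ _ _ _ _ _ := rfl

/-- The lift along `f.red` given by a chart of the target of `f`: functions on the reduced space of
the target are included into `𝒪_S` by the chart and then pulled back along `f`. -/
def Hom.chartLift {S' S : SuperSpace.{u, v} 𝕜} (f : Hom S' S) {U : Opens S.red.top} {n : ℕ}
    (c : S.Chart U n) : S'.LocalLift f.red ((Opens.map f.red.toTop).obj U) where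
  lift V W hU hV := (secRes S'.O (show W ≤ (Opens.map f.red.toTop).obj (V ⊓ U) from
    le_inf hV hU)).comp ((f.pull (V ⊓ U)).comp ((c.incl inf_le_right).comp (S.red.res inf_le_left)))
  lift_even _ _ _ _ _ := S'.res_even _ (f.map_even (c.incl_even _ _))
  ε_lift _ _ _ _ g := by
    refine (S'.ε_res _ _).trans ?_
    refine (congrArg (S'.red.res _) ((f.ε_sharp _).trans
      (congrArg (f.red.pull _) (c.ε_incl inf_le_right (S.red.res inf_le_left g))))).trans rfl
  secRes_lift _ _ _ _ _ _ _ := secRes_secRes S' _ _ _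
  lift_res V V' _ h _ _ _ g := by
    have h1 := c.incl_res (show V' ⊓ U ≤ V ⊓ U from inf_le_inf_right _ h) inf_le_right
      (S.red.res inf_le_left g)
    refine (congrArg (fun x => secRes S'.O _ (f.pull (V' ⊓ U) x)) h1).trans ?_
    refine (congrArg (secRes S'.O _) (f.pull_res _ _)).trans ?_
    exact secRes_secRes S' _ _ _

/-- The lift along the identity given by a projection of `S` to its reduced space. -/
def LocalLift.ofProjection (σ : ∀ U, S.red.Fn U →ₐ[𝕜] sec S.O U) (heven : ∀ U f, σ U f ∈ S.even U)
    (hres : ∀ {U V} (h : U ≤ V) (f : S.red.Fn V), σ U (S.red.res h f) = secRes S.O h (σ V f))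
    (hε : ∀ U f, S.ε U (σ U f) = f) (U : Opens S.red.top) :
    S.LocalLift (FunctionSpace.Hom.id S.red) U where
  lift V W _ hV := (secRes S.O (show W ≤ V from hV)).comp (σ V)
  lift_even _ _ _ _ _ := S.res_even _ (heven _ _)
  ε_lift V _ _ hV g := (S.ε_res _ _).trans (congrArg (S.red.res hV) (hε V g))
  secRes_lift _ _ _ _ _ _ _ := secRes_secRes S _ _ _
  lift_res _ _ _ h _ _ _ g :=
    (congrArg (secRes S.O _) (hres h g)).trans (secRes_secRes S _ _ _)

/-! ### Differences of lifts -/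

section Difference

variable (c : S.Chart U₀ n) (hU : U ≤ U₀) (L L' : S.LocalLift φ U)

theorem LocalLift.sub_mem_oddSquare (c : S.Chart U₀ n) (L L' : S.LocalLift φ U) (V : Opens Y.top)
    {W : Opens S.red.top} (hW₀ : W ≤ U₀) (hW : W ≤ U) (hV : W ≤ (Opens.map φ.toTop).obj V)
    (g : Y.Fn V) : L'.lift V W hW hV g - L.lift V W hW hV g ∈ S.oddSquare W := by
  refine c.mem_oddSquare hW₀ (sub_mem (L'.lift_even _ _ _ _ _) (L.lift_even _ _ _ _ _)) ?_
  rw [map_sub, L.ε_lift, L'.ε_lift, sub_self]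

/-- The pairing with `v ∧ w` of the difference of two lifts. The difference is a derivation modulo
the cube of the odd ideal, so this is a tangent vector of `Y`. -/
def liftDiffValue {q : S.red.top} (hq : q ∈ U) (v w : S.oddTangent q) : Y.tangent (φ.toTop q) :=
  ⟨fun V => c.pairing (W := U ⊓ (Opens.map φ.toTop).obj V.toOpens) (inf_le_left.trans hU)
      ⟨hq, V.mem⟩ v w ∘ₗ ((L'.lift V.toOpens _ inf_le_left inf_le_right).toLinearMap -
        (L.lift V.toOpens _ inf_le_left inf_le_right).toLinearMap), by
    refine ⟨fun V V' h g => ?_, fun V g g' => ?_⟩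
    · have hle : U ⊓ (Opens.map φ.toTop).obj V.toOpens ≤ U ⊓ (Opens.map φ.toTop).obj V'.toOpens :=
        inf_le_inf_left _ fun _ hx => h hx
      refine Eq.trans ?_ (c.pairing_eq c (inf_le_left.trans hU) (inf_le_left.trans hU) hle
        ⟨hq, V.mem⟩ v w (L.sub_mem_oddSquare c L' V'.toOpens (inf_le_left.trans hU) inf_le_left
          inf_le_right g)).symm
      rw [map_sub, L.secRes_lift, L'.secRes_lift]
      refine congrArg (c.pairing _ _ v w) ?_
      exact congrArg₂ (· - ·) (L'.lift_res _ _ _ h _ _ _ g) (L.lift_res _ _ _ h _ _ _ g)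
    · let a := L.lift V.toOpens (U ⊓ (Opens.map φ.toTop).obj V.toOpens) inf_le_left inf_le_right
      let a' := L'.lift V.toOpens (U ⊓ (Opens.map φ.toTop).obj V.toOpens) inf_le_left inf_le_right
      have hm := L.sub_mem_oddSquare c L' V.toOpens (inf_le_left.trans hU) inf_le_left inf_le_right
      -- Leibniz rule: modulo the cube of the odd ideal, `a` and `a'` act on the difference alike
      have e : a' (g * g') - a (g * g') = (a' g' - a g') * a g + (a' g - a g) * a' g' := by
        rw [map_mul, map_mul, sub_mul, sub_mul,
          S.even_comm (L'.lift_even _ _ _ _ g') (L.lift _ _ _ _ g),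
          S.even_comm (L.lift_even _ _ _ _ g') (L.lift _ _ _ _ g)]
        abel
      refine (congrArg (c.pairing _ _ v w) e).trans ((map_add _ _ _).trans
        (congrArg₂ (· + ·) ?_ ?_))
      · refine (c.pairing_mul_even _ _ v w (hm g') (L.lift_even _ _ _ _ g)).trans ?_
        rw [L.ε_lift]
        rfl
      · refine (c.pairing_mul_even _ _ v w (hm g) (L'.lift_even _ _ _ _ g')).trans ?_
        rw [L'.ε_lift]
        rfl⟩

/-- The value of the difference of two lifts can be computed in any chart and on any small
neighbourhood. -/
theorem liftDiffValue_apply (c' : S.Chart U' n') {q : S.red.top} (v w : S.oddTangent q)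
    {N : Opens S.red.top} (hN' : N ≤ U') (hN : N ≤ U) (V : Opens Y.top)
    (hV : N ≤ (Opens.map φ.toTop).obj V) (hq : q ∈ N) (g : Y.Fn V) :
    (liftDiffValue c hU L L' (hN hq) v w).1 ⟨V, hV hq⟩ g =
      c'.pairing hN' hq v w (L'.lift V N hN hV g - L.lift V N hN hV g) := by
  refine (c.pairing_eq c' (inf_le_left.trans hU) hN' (le_inf hN hV) hq v w
    (L.sub_mem_oddSquare c L' V (inf_le_left.trans hU) inf_le_left inf_le_right g)).trans ?_
  rw [map_sub, L.secRes_lift, L'.secRes_lift]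

theorem liftDiffValue_regular {W' : Opens S.red.top} (h : W' ≤ U)
    {v w : ∀ q : W', S.oddTangent q.1} (hv : S.IsOddField v) (hw : S.IsOddField w)
    {V : Opens Y.top} (hV : W' ≤ (Opens.map φ.toTop).obj V) (g : Y.Fn V) :
    (fun q : W' => (liftDiffValue c hU L L' (h q.2) (v q) (w q)).1 ⟨V, hV q.2⟩ g) ∈
      S.red.fn W' := by
  have hx := c.pairing_regular (W := U ⊓ (Opens.map φ.toTop).obj V) (inf_le_left.trans hU)
    (le_inf h hV) hv hw
    (L.sub_mem_oddSquare c L' V (inf_le_left.trans hU) inf_le_left inf_le_right g)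
  have e : ∀ q : W', (liftDiffValue c hU L L' (h q.2) (v q) (w q)).1 ⟨V, hV q.2⟩ g =
      c.pairing (W := U ⊓ (Opens.map φ.toTop).obj V) (inf_le_left.trans hU) (le_inf h hV q.2)
        (v q) (w q) (L'.lift V _ inf_le_left inf_le_right g -
          L.lift V _ inf_le_left inf_le_right g) := fun q => rfl
  simp only [e]
  exact hx

/-- The difference modulo the cube of the odd ideal of two lifts along `φ`, as a section of
`Hom(⋀² T₋S, φ^* T Y)`. -/
def liftDiff : S.homSections φ U :=
  ⟨fun q => alternatingOfBilinear (liftDiffValue c hU L L' q.2)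
    (fun v v' w => by
      apply Subtype.ext; funext V; apply LinearMap.ext; intro g
      exact c.pairing_add_left _ _ v v' w (L.sub_mem_oddSquare c L' _ (inf_le_left.trans hU) _ _ g))
    (fun r v w => by
      apply Subtype.ext; funext V; apply LinearMap.ext; intro g
      exact c.pairing_smul_left _ _ r v w
        (L.sub_mem_oddSquare c L' _ (inf_le_left.trans hU) _ _ g))
    (fun v w => by
      apply Subtype.ext; funext V; apply LinearMap.ext; intro g
      exact c.pairing_swap _ _ v w (L.sub_mem_oddSquare c L' _ (inf_le_left.trans hU) _ _ g))
    (fun v => by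
      apply Subtype.ext; funext V; apply LinearMap.ext; intro g
      exact c.pairing_self _ _ v (L.sub_mem_oddSquare c L' _ (inf_le_left.trans hU) _ _ g)),
  fun _ h _ _ hv hw _ hV g => liftDiffValue_regular c hU L L' h hv hw hV g⟩

end Difference

/-! ### Functoriality of the leading term -/

theorem Hom.pull_oddSquare {S' S : SuperSpace.{u, v} 𝕜} (f : Hom S' S) {W : Opens S.red.top}
    {x : sec S.O W} (hx : x ∈ S.oddSquare W) :
    f.pull W x ∈ S'.oddSquare ((Opens.map f.red.toTop).obj W) := by
  induction hx using AddSubgroup.closure_induction with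
  | mem x hx =>
    obtain ⟨a, ha, b, hb, rfl⟩ := hx
    rw [map_mul]
    exact AddSubgroup.subset_closure ⟨_, f.map_odd ha, _, f.map_odd hb, rfl⟩
  | zero => rw [map_zero]; exact zero_mem _
  | add x y _ _ h1 h2 => rw [map_add]; exact add_mem h1 h2
  | neg x _ h1 => rw [map_neg]; exact neg_mem h1

/-- The projection formula for the pairing of the square of the odd ideal with odd bivectors. -/
theorem Hom.pairing_oddDiff {S' S : SuperSpace.{u, v} 𝕜} (f : Hom S' S) {U : Opens S.red.top}
    {n : ℕ} (c : S.Chart U n) {U' : Opens S'.red.top} {n' : ℕ} (c' : S'.Chart U' n')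
    {W : Opens S.red.top} (hW : W ≤ U) {N : Opens S'.red.top} (hN : N ≤ U')
    (h : N ≤ (Opens.map f.red.toTop).obj W) {q : S'.red.top} (hq : q ∈ N)
    (v w : S'.oddTangent q) {x : sec S.O W} (hx : x ∈ S.oddSquare W) :
    c.pairing hW (p := f.red.toTop q) (h hq) (f.oddDiff q v) (f.oddDiff q w) x =
      c'.pairing hN hq v w (secRes S'.O h (f.pull W x)) := by
  induction hx using AddSubgroup.closure_induction with
  | mem x hx =>
    obtain ⟨a, ha, b, hb, rfl⟩ := hx
    have key : ∀ (u : S'.oddTangent q) (z : sec S.O W),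
        (f.oddDiff q u).1 ⟨W, h hq⟩ z = u.1 ⟨N, hq⟩ (secRes S'.O h (f.pull W z)) := fun u z =>
      (u.2.1 ⟨N, hq⟩ ⟨_, h hq⟩ h (f.pull W z)).symm
    have hm : secRes S'.O h (f.pull W (a * b)) =
        secRes S'.O h (f.pull W a) * secRes S'.O h (f.pull W b) := by
      rw [map_mul, map_mul]
    rw [hm]
    refine (c.pairing_mul hW (p := f.red.toTop q) (h hq) _ _ ha hb).trans ?_
    refine Eq.trans ?_
      (c'.pairing_mul hN hq v w (S'.res_odd h (f.map_odd ha)) (S'.res_odd h (f.map_odd hb))).symm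
    exact congrArg₂ (· - ·) (congrArg₂ (· * ·) (key v a) (key w b))
      (congrArg₂ (· * ·) (key w a) (key v b))
  | zero => simp only [map_zero]
  | add x y _ _ h1 h2 => simp only [map_add, h1, h2]
  | neg x _ h1 => simp only [map_neg, h1]

/-- The leading term of a transition, followed by the differential of a map `φ` of reduced
spaces, is the difference of the lifts along `φ` given by the two charts. -/
theorem Chart.leadingValue_localLift (c : S.Chart U n) (c' : S.Chart U' n') {U₁ : Opens S.red.top}
    {n₁ : ℕ} (c₁ : S.Chart U₁ n₁) (φ : FunctionSpace.Hom S.red Y) {N : Opens S.red.top}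
    (hN : N ≤ U) (hN' : N ≤ U') (hN₁ : N ≤ U₁) {q : S.red.top} (hq : q ∈ N)
    (v w : S.oddTangent q) (V : Opens Y.top) (hV : N ≤ (Opens.map φ.toTop).obj V) (g : Y.Fn V) :
    (φ.diff q (c.leadingValue c' ⟨hN hq, hN' hq⟩ v w)).1 ⟨V, hV hq⟩ g =
      c₁.pairing hN₁ hq v w
        ((c'.localLift φ).lift V N hN' hV g - (c.localLift φ).lift V N hN hV g) := by
  have hle : N ≤ (Opens.map φ.toTop).obj V ⊓ (U ⊓ U') := le_inf hV (le_inf hN hN')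
  refine (c.pairing_eq c₁ (inf_le_right.trans inf_le_left) hN₁ hle hq v w
    (c.inclDiff_mem c' inf_le_right (S.red.res inf_le_left (φ.pull V g)))).trans ?_
  rw [← c.inclDiff_res c' hle inf_le_right]
  rfl

/-- The leading term of a transition of the target, composed with the odd differential of `f`, is
the difference of the lifts along `f` given by the two charts. -/
theorem Hom.leadingValue_chartLift {S' S : SuperSpace.{u, v} 𝕜} (f : Hom S' S)
    {U U' : Opens S.red.top} {n n' : ℕ} (c : S.Chart U n) (c' : S.Chart U' n')
    {U₁ : Opens S'.red.top} {n₁ : ℕ} (c₁ : S'.Chart U₁ n₁) {N : Opens S'.red.top}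
    (hN : N ≤ (Opens.map f.red.toTop).obj U) (hN' : N ≤ (Opens.map f.red.toTop).obj U')
    (hN₁ : N ≤ U₁) {q : S'.red.top} (hq : q ∈ N) (v w : S'.oddTangent q) (V : Opens S.red.top)
    (hV : N ≤ (Opens.map f.red.toTop).obj V) (g : S.red.Fn V) :
    (c.leadingValue c' (q := f.red.toTop q) ⟨hN hq, hN' hq⟩ (f.oddDiff q v) (f.oddDiff q w)).1
        ⟨V, hV hq⟩ g =
      c₁.pairing hN₁ hq v w
        ((f.chartLift c').lift V N hN' hV g - (f.chartLift c).lift V N hN hV g) := by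
  have hle : N ≤ (Opens.map f.red.toTop).obj (V ⊓ (U ⊓ U')) := le_inf hV (le_inf hN hN')
  have hx := c.inclDiff_mem c' inf_le_right (S.red.res (inf_le_left : V ⊓ (U ⊓ U') ≤ V) g)
  refine (f.pairing_oddDiff c c₁ (inf_le_right.trans inf_le_left) hN₁ hle hq v w hx).trans ?_
  refine congrArg (c₁.pairing hN₁ hq v w) ?_
  have key : ∀ {A : Opens S.red.top} {m : ℕ} (d : S.Chart A m) (hA : U ⊓ U' ≤ A)
      (hNA : N ≤ (Opens.map f.red.toTop).obj A),
      secRes S'.O hle (f.pull _ (d.incl (inf_le_right.trans hA) (S.red.res inf_le_left g))) =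
        (f.chartLift d).lift V N hNA hV g := by
    intro A m d hA hNA
    have h1 := d.incl_res (show V ⊓ (U ⊓ U') ≤ V ⊓ A from inf_le_inf_left _ hA) inf_le_right
      (S.red.res inf_le_left g)
    refine (congrArg (fun x => secRes S'.O hle (f.pull _ x)) h1).trans ?_
    refine (congrArg (secRes S'.O hle) (f.pull_res _ _)).trans ?_
    exact secRes_secRes S' _ _ _
  rw [← key c inf_le_left, ← key c' inf_le_right, ← map_sub, ← map_sub]
  rfl

/-! ### Comparison of obstruction classes -/

/-- The morphism of sheaves `Hom(⋀² T₋S', f^* T₊S) → Hom(⋀² T₋S', T₊S')` given by a morphism of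
bundles `r : f^* T₊S → T₊S'`. -/
def Hom.retractSheaf {S' S : SuperSpace.{u, v} 𝕜} (f : Hom S' S)
    (r : ∀ q : S'.red.top, S.red.tangent (f.red.toTop q) →ₗ[𝕜] S'.red.tangent q)
    (hr : ∀ (W : Opens S'.red.top) (X : ∀ q : W, S.red.tangent (f.red.toTop q.1)),
      (∀ (W' : Opens S'.red.top) (h : W' ≤ W) (V : Opens S.red.top)
        (hV : W' ≤ (Opens.map f.red.toTop).obj V) (g : S.red.Fn V),
        (fun q : W' => (X ⟨q.1, h q.2⟩).1 ⟨V, hV q.2⟩ g) ∈ S'.red.fn W') →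
      ∀ (V : Opens S'.red.top) (h : V ≤ W) (g : S'.red.Fn V),
        (fun q : V => (r q.1 (X ⟨q.1, h q.2⟩)).1 ⟨V, q.2⟩ g) ∈ S'.red.fn V) :
    S'.homSheaf f.red ⟶ S'.homSheafSelf where
  app W := AddCommGrpCat.ofHom
    { toFun := fun B => ⟨fun q => (r q.1).compAlternatingMap (B.1 q), by
        intro W' h v w hv hw V hV g
        have h1 := hr W' (fun q => B.1 ⟨q.1, h q.2⟩ ![v q, w q])
          (fun W'' h' V' hV' g' => B.2 W'' (h'.trans h) (fun q => v ⟨q.1, h' q.2⟩)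
            (fun q => w ⟨q.1, h' q.2⟩) (fun V'' h'' x => hv V'' (h''.trans h') x)
            (fun V'' h'' x => hw V'' (h''.trans h') x) V' hV' g') W' le_rfl (S'.red.res hV g)
        have e : ∀ q : W', (r q.1 (B.1 ⟨q.1, h q.2⟩ ![v q, w q])).1 ⟨W', q.2⟩ (S'.red.res hV g) =
            (r q.1 (B.1 ⟨q.1, h q.2⟩ ![v q, w q])).1 ⟨V, hV q.2⟩ g := fun q =>
          (r q.1 (B.1 ⟨q.1, h q.2⟩ ![v q, w q])).2.1 ⟨W', q.2⟩ ⟨V, hV q.2⟩ hV g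
        simp only [e] at h1
        exact h1⟩
      map_zero' := by
        apply Subtype.ext; funext q; apply AlternatingMap.ext; intro t
        exact map_zero (r q.1)
      map_add' := fun B B' => by
        apply Subtype.ext; funext q; apply AlternatingMap.ext; intro t
        exact map_add (r q.1) _ _ }
  naturality _ _ _ := rfl

theorem Hom.jSheaf_retractSheaf {S' S : SuperSpace.{u, v} 𝕜} (f : Hom S' S)
    (r : ∀ q : S'.red.top, S.red.tangent (f.red.toTop q) →ₗ[𝕜] S'.red.tangent q)
    (h : ∀ q v, r q (f.red.diff q v) = v) (hr) : f.jSheaf ≫ f.retractSheaf r hr = 𝟙 _ := by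
  apply NatTrans.ext; funext W
  apply AddCommGrpCat.hom_ext; apply AddMonoidHom.ext; intro B
  apply Subtype.ext; funext q; apply AlternatingMap.ext; intro t
  exact h q.1 _

end SuperSpace

namespace Supermanifold

variable {𝕜 : Type w} [RCLike 𝕜] {g : Geometry}

open SuperSpace

/-- The cover of the reduced space of `S'` by the domains on which both a chart of `S'` and, through
`f`, a chart of `S` are available. -/
noncomputable def comparisonCover (S S' : Supermanifold.{u, v} 𝕜 g)
    (f : SuperSpace.Hom S'.toSuperSpace S.toSuperSpace) : PointCover S'.red.top :=
  fun p => OrderDual.toDual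
    ⟨S'.chartDomain p ⊓ (Opens.map f.red.toTop).obj (S.chartDomain (f.red.toTop p)),
      S'.mem_chartDomain p, S.mem_chartDomain (f.red.toTop p)⟩

/-- On the domain of charts of `S'` and `S`, the difference of the two lifts of functions on the
reduced space of `S` to `𝒪_S'`: pull back to a function and include it by the chart of `S'`, or
include it by the chart of `S` and pull back. -/
noncomputable def comparisonCochain (S S' : Supermanifold.{u, v} 𝕜 g)
    (f : SuperSpace.Hom S'.toSuperSpace S.toSuperSpace) (p : S'.red.top) :
    S'.homSections f.red ((S.comparisonCover S' f).at p) :=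
  liftDiff (S'.chartAt p) inf_le_left
    ((f.chartLift (S.chartAt (f.red.toTop p))).restrict inf_le_right)
    (((S'.chartAt p).localLift f.red).restrict inf_le_left)

theorem map_omega2_eq_pull_omega2 (S S' : Supermanifold.{u, v} 𝕜 g)
    (f : SuperSpace.Hom S'.toSuperSpace S.toSuperSpace) :
    H1.map f.jSheaf S'.omega2 = H1.pull f.red.toTop (S.ιSheaf f) S.omega2 := by
  unfold omega2 H1.map
  rw [H1.pull_mk (𝟙 S'.red.top) (toPushforwardId f.jSheaf) S'.chartCover
      (S.comparisonCover S' f) (fun _ => inf_le_left),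
    H1.pull_mk f.red.toTop (S.ιSheaf f) S.chartCover (S.comparisonCover S' f)
      (fun _ => inf_le_right),
    ← sub_eq_zero, ← map_sub,
    ← H1.mk_coboundary (S'.homSheaf f.red) (S.comparisonCover S' f) (S.comparisonCochain S' f)]
  refine congrArg (H1.mk _ _) ?_
  apply Subtype.ext; funext x y
  apply Subtype.ext; funext q
  apply AlternatingMap.ext; intro t
  apply Subtype.ext; funext V; apply LinearMap.ext; intro G
  -- all terms of the identity are pairings on `N` in the chart of `S'` at `x`
  let N : Opens S'.red.top := (S.comparisonCover S' f).at x ⊓ (S.comparisonCover S' f).at y ⊓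
    (Opens.map f.red.toTop).obj V.toOpens
  have hq : q.1 ∈ N := ⟨q.2, V.mem⟩
  have hx : N ≤ (S.comparisonCover S' f).at x := inf_le_left.trans inf_le_left
  have hy : N ≤ (S.comparisonCover S' f).at y := inf_le_left.trans inf_le_right
  have hV : N ≤ (Opens.map f.red.toTop).obj V.toOpens := inf_le_right
  have hx' : N ≤ S'.chartDomain x := hx.trans inf_le_left
  have hy' : N ≤ S'.chartDomain y := hy.trans inf_le_left
  have h1 := (S'.chartAt x).leadingValue_localLift (S'.chartAt y) (S'.chartAt x) f.red
    hx' hy' hx' hq (t 0) (t 1) V.toOpens hV G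
  have h2 := f.leadingValue_chartLift (S.chartAt (f.red.toTop x)) (S.chartAt (f.red.toTop y))
    (S'.chartAt x) (hx.trans inf_le_right) (hy.trans inf_le_right) hx' hq (t 0) (t 1)
    V.toOpens hV G
  have h3 := liftDiffValue_apply (S'.chartAt x) inf_le_left
    ((f.chartLift (S.chartAt (f.red.toTop x))).restrict inf_le_right)
    (((S'.chartAt x).localLift f.red).restrict inf_le_left) (S'.chartAt x) (t 0) (t 1)
    hx' hx V.toOpens hV hq G
  have h4 := liftDiffValue_apply (S'.chartAt y) inf_le_left
    ((f.chartLift (S.chartAt (f.red.toTop y))).restrict inf_le_right)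
    (((S'.chartAt y).localLift f.red).restrict inf_le_left) (S'.chartAt x) (t 0) (t 1)
    hx' hy V.toOpens hV hq G
  refine (congrArg₂ (· - ·) h1 h2).trans (Eq.trans ?_ (congrArg₂ (· - ·) h4 h3).symm)
  simp only [LocalLift.restrict, map_sub]
  ring

theorem omega2_eq_zero_of_isProjected (S : Supermanifold.{u, v} 𝕜 g) (hS : S.IsProjected) :
    S.omega2 = 0 := by
  obtain ⟨σ, heven, hres, hε⟩ := hS
  have hmk := H1.mk_coboundary S.homSheafSelf S.chartCover fun p =>
    liftDiff (S.chartAt p) le_rfl (LocalLift.ofProjection σ heven hres hε (S.chartDomain p))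
      ((S.chartAt p).localLift (FunctionSpace.Hom.id S.red))
  rw [← hmk]
  refine congrArg (H1.mk _ _) ?_
  apply Subtype.ext; funext x y
  apply Subtype.ext; funext q
  apply AlternatingMap.ext; intro t
  apply Subtype.ext; funext V; apply LinearMap.ext; intro G
  let N : Opens S.red.top := S.chartDomain x ⊓ S.chartDomain y ⊓ V.toOpens
  have hq : q.1 ∈ N := ⟨q.2, V.mem⟩
  have hx : N ≤ S.chartDomain x := inf_le_left.trans inf_le_left
  have hy : N ≤ S.chartDomain y := inf_le_left.trans inf_le_right
  have hV : N ≤ (Opens.map (FunctionSpace.Hom.id S.red).toTop).obj V.toOpens := inf_le_right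
  have h1 := (S.chartAt x).leadingValue_localLift (S.chartAt y) (S.chartAt x)
    (FunctionSpace.Hom.id S.red) hx hy hx hq (t 0) (t 1) V.toOpens hV G
  have h2 := fun (p : S.red.top) (hp : N ≤ S.chartDomain p) =>
    liftDiffValue_apply (S.chartAt p) le_rfl
      (LocalLift.ofProjection σ heven hres hε (S.chartDomain p))
      ((S.chartAt p).localLift (FunctionSpace.Hom.id S.red)) (S.chartAt x) (t 0) (t 1)
      hx hp V.toOpens hV hq G
  refine Eq.trans h1 (Eq.trans ?_ (congrArg₂ (· - ·) (h2 y hy) (h2 x hx)).symm)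
  simp only [LocalLift.ofProjection, map_sub]
  ring

/-- If the even normal sequence splits, `j` does not kill a non-zero obstruction class. -/
theorem omega2_eq_zero_of_map_eq_zero {S' : Supermanifold.{u, v} 𝕜 g} {S : SuperSpace.{u, v} 𝕜}
    (f : SuperSpace.Hom S'.toSuperSpace S) (hf : f.NormalSequenceSplits)
    (h : H1.map f.jSheaf S'.omega2 = 0) : S'.omega2 = 0 := by
  obtain ⟨r, hr, hreg⟩ := hf
  have h1 := H1.map_map_mk f.jSheaf (f.retractSheaf r hreg) (f.jSheaf_retractSheaf r hr hreg)
    S'.chartCover S'.obstructionCocycle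
  exact h1.symm.trans ((congrArg (H1.map (f.retractSheaf r hreg)) h).trans (map_zero _))

end Supermanifold

end SuperGeometry

theorem mainTheorem4 {𝕜 : Type w} [RCLike 𝕜] (g : SuperGeometry.Geometry)
    (S S' : SuperGeometry.Supermanifold.{u, v, w} 𝕜 g)
    (f : SuperGeometry.SuperSpace.Hom S'.toSuperSpace S.toSuperSpace) (hf : f.IsSubmanifold) :
    SuperGeometry.H1.map f.jSheaf S'.omega2 =
        SuperGeometry.H1.pull f.red.toTop (S.ιSheaf f) S.omega2 ∧
      (f.NormalSequenceSplits → S'.omega2 ≠ 0 → S.omega2 ≠ 0 ∧ ¬ S.IsProjected) := by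
  have h := S.map_omega2_eq_pull_omega2 S' f
  refine ⟨h, fun hs h0 => ?_⟩
  have hS : S.omega2 ≠ 0 := fun hS => h0 <|
    SuperGeometry.Supermanifold.omega2_eq_zero_of_map_eq_zero f hs <| by rw [h, hS, map_zero]
  exact ⟨hS, fun hp => hS (S.omega2_eq_zero_of_isProjected hp)⟩
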